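/- Let $n,m\ge 0$ be integers. Let $\varphi_1,\dots,\varphi_m$ be smooth real functions on an open simply connected set $U\subset\mathbb R^n$ with commuting Hessians, $[\operatorname{Hess}\varphi_i,\operatorname{Hess}\varphi_j]=0$ on $U$ for $1\le i,j\le m$; let $\mathcal G=(\nabla\varphi_1,\dots,\nabla\varphi_m):U\to M_{n\times m}(\mathbb R)$, and let $\Omega:V\to GL(\mathbb R^m)$ be a smooth map on an open set $V\subset U$ such that $d\Omega=\mathcal G^t\,d\mathcal G$ and $\Omega+\Omega^t=\mathcal G^t\mathcal G+I$ on $V$. Then the $M_{(n+m)\times m}(\mathbb R)$-valued map $$W=\begin{pmatrix}\mathcal G\,\Omega^{-1}\\ I-\Omega^{-1}\end{pmatrix}$$ satisfies $W^tW=I$ on $V$, and each of its columns defines, on the open set of its regular points (the points of $V$ where its differential is injective), the position vector of an immersion into the unit sphere $\mathbb S^{n+m-1}\subset\mathbb R^{n+m}$ with flat normal bundle (the normal connection of the immersion into the sphere has zero curvature). Conversely, let $f:M^n\to\mathbb S^{n+m-1}$ be an isometric immersion with flat normal bundle of an $n$-dimensional manifold (that is, a smooth immersion, $M^n$ being endowed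 with the induced metric). Then, up to a rigid motion of the sphere, $f$ can be constructed locally in this way: for each $p\in M$ and each $j\in\{1,\dots,m\}$ there are $U$, $V$, $\varphi_1,\dots,\varphi_m$ and $\Omega$ as above, a linear isometry $T$ of $\mathbb R^{n+m}$, and a diffeomorphism $\psi$ of $V$ onto an open neighbourhood of $p$ in $M$, such that $T\circ f\circ\psi$ is the $j$-th column of $W$ on $V$. -/

import Mathlib

open scoped ContDiff Manifold Gradient

noncomputable section

namespace FlatNormal

/-- The space `ℝⁿ` with its Euclidean inner product. -/
abbrev Eucl (n : ℕ) : Type := EuclideanSpace ℝ (Fin n)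

/-- The space `ℝⁿ⁺ᵐ = ℝⁿ × ℝᵐ` with its Euclidean inner product: the coordinates are indexed by
`Fin n ⊕ Fin m`. Its unit sphere is `𝕊ⁿ⁺ᵐ⁻¹`. -/
abbrev Amb (n m : ℕ) : Type := EuclideanSpace ℝ (Fin n ⊕ Fin m)

/-! ### Immersions into the unit sphere and their normal bundle -/

section Sphere

variable {E F : Type*} [NormedAddCommGroup E] [NormedSpace ℝ E]
  [NormedAddCommGroup F] [InnerProductSpace ℝ F] [FiniteDimensional ℝ F]

/-- The normal space at `x` of an immersion `g` into the unit sphere of `F`: the vectors of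
`T_{g x} 𝕊 = (ℝ · g x)ᗮ` that are orthogonal to the image of the differential of `g` at `x`. -/
def normalSpace (g : E → F) (x : E) : Submodule ℝ F :=
  (Submodule.span ℝ {g x} ⊔ (fderiv ℝ g x : E →ₗ[ℝ] F).range)ᗮ

/-- The normal connection `∇^⊥_v ξ`, for a field `ξ` along `g` and a constant vector field `v` on
the domain: the orthogonal projection of the derivative of `ξ` in the direction `v` to the normal
space of `g` in the sphere. -/
def normalDeriv (g : E → F) (v : E) (ξ : E → F) (x : E) : F :=
  (normalSpace g x).starProjection (fderiv ℝ ξ x v)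

/-- The curvature `R^⊥(v, w) ξ` of the normal connection vanishes on `R`, for all normal fields `ξ`.
As `v` and `w` are constant vector fields, the term with their Lie bracket is zero. -/
def NormalCurvatureZeroOn (g : E → F) (R : Set E) : Prop :=
  ∀ ξ : E → F, ContDiffOn ℝ ∞ ξ R → (∀ x ∈ R, ξ x ∈ normalSpace g x) →
    ∀ v w : E, ∀ x ∈ R,
      normalDeriv g v (normalDeriv g w ξ) x - normalDeriv g w (normalDeriv g v ξ) x = 0

/-- `g` restricts on the open set `R` to a smooth immersion into the unit sphere of `F`, with flat
normal bundle (in the sphere). -/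
structure IsSphericalImmersionWithFlatNormalBundleOn (g : E → F) (R : Set E) : Prop where
  isOpen : IsOpen R
  contDiffOn : ContDiffOn ℝ ∞ g R
  mem_sphere : ∀ x ∈ R, g x ∈ Metric.sphere (0 : F) 1
  injective_fderiv : ∀ x ∈ R, Function.Injective (fderiv ℝ g x)
  flat : NormalCurvatureZeroOn g R

/-- `f` is a smooth immersion of the `n`-dimensional manifold `M` into the unit sphere of `F`, with
flat normal bundle (in the sphere). The curvature of the normal connection is computed in the smooth
charts of `M`. -/
structure IsSphericalImmersionWithFlatNormalBundle (n : ℕ) {M : Type*} [TopologicalSpace M]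
    [ChartedSpace (Eucl n) M] (f : M → F) : Prop where
  contMDiff : ContMDiff (𝓡 n) 𝓘(ℝ, F) ∞ f
  mem_sphere : ∀ p, f p ∈ Metric.sphere (0 : F) 1
  injective_mfderiv : ∀ p, Function.Injective (mfderiv (𝓡 n) 𝓘(ℝ, F) f p)
  flat : ∀ e ∈ IsManifold.maximalAtlas (𝓡 n) ∞ M, NormalCurvatureZeroOn (f ∘ e.symm) e.target

end Sphere

/-! ### The data `(U, φ, 𝒢, V, Ω)` and the matrix `W` -/

section Data

variable {n m : ℕ}

/-- The Hessian of `ψ` at `x`, as the endomorphism `v ↦ ∇_v (grad ψ)` of `ℝⁿ`. -/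
def hess (ψ : Eucl n → ℝ) (x : Eucl n) : Eucl n →L[ℝ] Eucl n :=
  fderiv ℝ (∇ ψ) x

/-- The `n × m` matrix `𝒢 = (∇φ₁, …, ∇φₘ)`. -/
def gradMatrix (φ : Fin m → Eucl n → ℝ) (x : Eucl n) : Matrix (Fin n) (Fin m) ℝ :=
  Matrix.of fun a i => (∇ (φ i) x) a

/-- The differential `dA(x)(v)` of a matrix-valued map `A`, entry by entry. -/
def matrixDeriv {ι κ : Type*} (A : Eucl n → Matrix ι κ ℝ) (x v : Eucl n) : Matrix ι κ ℝ :=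
  Matrix.of fun a b => fderiv ℝ (fun y => A y a b) x v

/-- `φ₁, …, φₘ` are smooth functions with commuting Hessians on the open simply connected set `U`,
and `Ω : V → GL(ℝᵐ)` is a smooth map on an open set `V ⊆ U` with `dΩ = 𝒢ᵗ d𝒢` and
`Ω + Ωᵗ = 𝒢ᵗ 𝒢 + I`. -/
structure IsRibaucourData (U V : Set (Eucl n)) (φ : Fin m → Eucl n → ℝ)
    (Ω : Eucl n → Matrix (Fin m) (Fin m) ℝ) : Prop where
  isOpen_U : IsOpen U
  simplyConnected_U : SimplyConnectedSpace U
  contDiffOn_φ : ∀ i, ContDiffOn ℝ ∞ (φ i) U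
  commute_hess : ∀ i j, ∀ x ∈ U, Commute (hess (φ i) x) (hess (φ j) x)
  isOpen_V : IsOpen V
  V_subset_U : V ⊆ U
  contDiffOn_Ω : ∀ i j, ContDiffOn ℝ ∞ (fun x => Ω x i j) V
  isUnit_Ω : ∀ x ∈ V, IsUnit (Ω x)
  deriv_Ω : ∀ x ∈ V, ∀ v,
    matrixDeriv Ω x v = (gradMatrix φ x).transpose * matrixDeriv (gradMatrix φ) x v
  symm_Ω : ∀ x ∈ V,
    Ω x + (Ω x).transpose = (gradMatrix φ x).transpose * gradMatrix φ x + 1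

/-- The `(n + m) × m` matrix `W` with the blocks `𝒢 Ω⁻¹` (above) and `I - Ω⁻¹` (below). -/
def matW (φ : Fin m → Eucl n → ℝ) (Ω : Eucl n → Matrix (Fin m) (Fin m) ℝ) (x : Eucl n) :
    Matrix (Fin n ⊕ Fin m) (Fin m) ℝ :=
  Matrix.fromRows (gradMatrix φ x * (Ω x)⁻¹) (1 - (Ω x)⁻¹)

/-- The `j`-th column of `W`, as a map into `ℝⁿ⁺ᵐ`. -/
def colW (φ : Fin m → Eucl n → ℝ) (Ω : Eucl n → Matrix (Fin m) (Fin m) ℝ) (j : Fin m)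
    (x : Eucl n) : Amb n m :=
  WithLp.toLp 2 fun a => matW φ Ω x a j

/-- The regular points in `V` of the `j`-th column of `W`. -/
def regularSet (V : Set (Eucl n)) (φ : Fin m → Eucl n → ℝ)
    (Ω : Eucl n → Matrix (Fin m) (Fin m) ℝ) (j : Fin m) : Set (Eucl n) :=
  {x | x ∈ V ∧ Function.Injective (fderiv ℝ (colW φ Ω j) x)}

end Data

end FlatNormal

end

/-!
The link between the two directions is the notion of an orthonormal frame `X₁, …, Xₘ : V → ℝⁿ⁺ᵐ` with
`⟪X i, dX k⟫ = 0` for all `i`, `k`; in terms of the matrix `W` with the columns `X k` this says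
`Wᵗ W = I` and `Wᵗ dW = 0`.

A member `X j` of such a frame is, where it is immersed, a spherical immersion with flat normal
bundle: by dimension the other members span its normal bundle, and they are parallel
(`isSphericalImmersionWithFlatNormalBundleOn_of_frame`). For the matrix `W` built from `𝒢` and `Ω`,
the identities `Wᵗ W = I` and `Wᵗ dW = 0` are pure matrix algebra from `dΩ = 𝒢ᵗ d𝒢` and
`Ω + Ωᵗ = 𝒢ᵗ 𝒢 + I` (`gram_of_symm`, `deriv_gram_of_symm`).

Conversely, a spherical immersion `g` with flat normal bundle is locally a member of such a frame,
the others being parallel normal fields (`exists_frame`). Their existence is the integrability of a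
flat connection. On a trivial bundle over a ball, the Picard iteration along rays for `dξ = a ξ`
converges, and flatness makes the defects `dξ - a ξ` of the iterates tend to zero uniformly, so that
the limit is differentiable and parallel (`exists_parallel_of_isFlatAt`). The normal bundle is the
image of a smooth field of projectors `P` whose curvature is `P [dP, dP]`, and is trivialized by
`Φ = P P₀ + (1 - P) (1 - P₀)` (`exists_parallel_of_projector`).

Given the frame, a linear isometry takes `X k` at the base point to minus the `k`-th of the last `m`
basis vectors. Then `I - W₂` is invertible there, where `W₁`, `W₂` are the blocks of `W`, and
`Ω = (I - W₂)⁻¹`, `G = W₁ Ω` satisfy both relations, again by algebra (`symm_of_gram`,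
`deriv_of_gram`). At the base point `dG_j = ½ dW₁_j` is injective, so the column `G_j` is a coordinate
system. In these coordinates, the exterior derivative of `dΩ = Gᵗ dG` reads
`⟪dG_i u, dG_k v⟫ = ⟪dG_i v, dG_k u⟫`. Taking `i = j`, where `dG_j` is the identity, each `dG_k` is
self-adjoint, so `G_k` is a gradient on a ball; the general case then says that these Hessians commute
(`exists_isRibaucourData_of_column_eq_id`).
-/

namespace FlatNormal

open Set Filter Topology

/-! ### Parallel sections of flat connections on trivial bundles -/

section FlatConnection

variable {E G : Type*} [NormedAddCommGroup E] [NormedSpace ℝ E] [FiniteDimensional ℝ E]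
  [NormedAddCommGroup G] [NormedSpace ℝ G]

theorem hasFDerivAt_integral_of_continuous {F : E → ℝ → G} {F' : E → ℝ → E →L[ℝ] G}
    (hF : ∀ x t, HasFDerivAt (fun y => F y t) (F' x t) x)
    (hc : Continuous fun p : E × ℝ => F p.1 p.2)
    (hc' : Continuous fun p : E × ℝ => F' p.1 p.2) (x : E) :
    HasFDerivAt (fun y => ∫ t in (0 : ℝ)..1, F y t) (∫ t in (0 : ℝ)..1, F' x t) x := by
  obtain ⟨C, hC⟩ := ((isCompact_closedBall x 1).prod
    (isCompact_Icc (a := (0 : ℝ)) (b := 1))).exists_bound_of_continuousOn hc'.continuousOn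
  have hcx : ∀ y, Continuous (F y) := fun y => hc.comp (Continuous.prodMk_right y)
  have hcx' : ∀ y, Continuous (F' y) := fun y => hc'.comp (Continuous.prodMk_right y)
  refine intervalIntegral.hasFDerivAt_integral_of_dominated_of_fderiv_le (s := Metric.ball x 1)
    (bound := fun _ => C) (Metric.ball_mem_nhds x one_pos) ?_ ?_ ?_ ?_ ?_ ?_
  · exact Eventually.of_forall fun y => (hcx y).aestronglyMeasurable
  · exact (hcx x).intervalIntegrable _ _
  · exact (hcx' x).aestronglyMeasurable
  · refine Eventually.of_forall fun t ht y hy => hC (y, t) ⟨Metric.ball_subset_closedBall hy, ?_⟩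
    rw [uIoc_of_le zero_le_one] at ht
    exact ⟨ht.1.le, ht.2⟩
  · exact intervalIntegrable_const
  · exact Eventually.of_forall fun t _ y _ => hF y t

/-- The homotopy formula on the ray from the origin to `x`. -/
theorem hasFDerivAt_radial_integral [CompleteSpace G] {α : E → E →L[ℝ] G} {α' : E → E →L[ℝ] E →L[ℝ] G}
    (hα : ∀ x, HasFDerivAt α (α' x) x) (hα' : Continuous α') (x : E) :
    HasFDerivAt (fun y => ∫ t in (0 : ℝ)..1, α (t • y) y)
      (α x + ∫ t in (0 : ℝ)..1, t • ((α' (t • x)).flip x - α' (t • x) x)) x := by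
  have hαc : Continuous α := continuous_iff_continuousAt.2 fun x => (hα x).continuousAt
  have hflip : Continuous fun p : E × ℝ => (α' (p.2 • p.1)).flip :=
    (ContinuousLinearMap.flipₗᵢ ℝ E E G).continuous.comp (by fun_prop)
  have h1 := hasFDerivAt_integral_of_continuous (F := fun y t => α (t • y) y)
    (F' := fun y t => α (t • y) + t • (α' (t • y)).flip y) (fun y t => by
      have h2 : HasFDerivAt (fun z : E => t • z) (t • ContinuousLinearMap.id ℝ E) y :=
        (hasFDerivAt_id y).const_smul t
      have h3 := ((hα (t • y)).comp y h2).clm_apply (hasFDerivAt_id y)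
      refine h3.congr_fderiv ?_
      ext v
      simp) (by fun_prop) (by fun_prop) x
  refine h1.congr_fderiv ?_
  have h4 : α x = ∫ t in (0 : ℝ)..1, (α (t • x) + t • α' (t • x) x) := by
    have h5 : ∀ t ∈ uIcc (0 : ℝ) 1, HasDerivAt (fun t : ℝ => t • α (t • x))
        (α (t • x) + t • α' (t • x) x) t := fun t _ => by
      have h6 : HasDerivAt (fun t : ℝ => t • x) x t := by
        simpa using (hasDerivAt_id t).smul_const x
      have h7 : HasDerivAt (fun t : ℝ => t • α (t • x)) (t • α' (t • x) x + (1 : ℝ) • α (t • x)) t :=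
        (hasDerivAt_id t).smul ((hα (t • x)).comp_hasDerivAt t h6)
      rwa [one_smul, add_comm] at h7
    rw [intervalIntegral.integral_eq_sub_of_hasDerivAt h5]
    · simp
    · exact Continuous.intervalIntegrable (by fun_prop) _ _
  have hf1 : Continuous fun t : ℝ => (α' (t • x)).flip :=
    hflip.comp (Continuous.prodMk_right x)
  rw [h4, ← intervalIntegral.integral_add]
  · refine intervalIntegral.integral_congr fun t _ => ?_
    simp only [smul_sub]
    abel
  · exact Continuous.intervalIntegrable (by fun_prop) _ _
  · exact Continuous.intervalIntegrable (by fun_prop) _ _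


/-- One step of the Picard iteration, along the rays from the origin, for the equation
`dξ = a ξ` with the initial value `ξ₀` at the origin. -/
noncomputable def picardStep (a : E → E →L[ℝ] G →L[ℝ] G) (ξ₀ : G) (ξ : E → G) (x : E) : G :=
  ξ₀ + ∫ t in (0 : ℝ)..1, a (t • x) x (ξ (t • x))

omit [FiniteDimensional ℝ E] in
theorem contDiff_clm_flip {F : Type*} [NormedAddCommGroup F] [NormedSpace ℝ F]
    {n : WithTop ℕ∞} : ContDiff ℝ n fun b : E →L[ℝ] G →L[ℝ] F => b.flip := by
  have h : IsBoundedLinearMap ℝ fun b : E →L[ℝ] G →L[ℝ] F => b.flip := by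
    refine ⟨⟨fun _ _ => rfl, fun _ _ => rfl⟩, 1, one_pos, fun b => ?_⟩
    rw [ContinuousLinearMap.opNorm_flip, one_mul]
  exact IsBoundedLinearMap.contDiff (E := E →L[ℝ] G →L[ℝ] F) (F := G →L[ℝ] E →L[ℝ] F) h

omit [FiniteDimensional ℝ E] in
theorem fderiv_flip_apply {a : E → E →L[ℝ] G →L[ℝ] G} {ξ : E → G} {x : E}
    (ha : DifferentiableAt ℝ a x) (hξ : DifferentiableAt ℝ ξ x) (u v : E) :
    fderiv ℝ (fun y => (a y).flip (ξ y)) x u v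
      = fderiv ℝ a x u v (ξ x) + a x v (fderiv ℝ ξ x u) := by
  have hflip : DifferentiableAt ℝ (fun y => (a y).flip) x :=
    (contDiff_clm_flip.differentiable one_ne_zero (a x)).comp x ha
  have hav : HasFDerivAt (fun y => a y v) ((fderiv ℝ a x).flip v) x := by
    simpa using ha.hasFDerivAt.clm_apply (hasFDerivAt_const v x)
  have h1 : fderiv ℝ (fun y => (a y).flip (ξ y)) x u v
      = fderiv ℝ (fun y => (a y).flip (ξ y) v) x u := by
    rw [fderiv_clm_apply (hflip.clm_apply hξ) (differentiableAt_const v)]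
    simp
  rw [h1]
  simp only [ContinuousLinearMap.flip_apply]
  rw [(hav.clm_apply hξ.hasFDerivAt).fderiv]
  simp [add_comm]

/-- The derivative of a Picard step is `a ξ`, up to an integral of the curl of the form `a ξ`. -/
theorem contDiff_picardStep [CompleteSpace G] {a : E → E →L[ℝ] G →L[ℝ] G} (ha : ContDiff ℝ 1 a)
    (ξ₀ : G) {ξ : E → G} (hξ : ContDiff ℝ 1 ξ) :
    ContDiff ℝ 1 (picardStep a ξ₀ ξ) ∧
    ∀ x, fderiv ℝ (picardStep a ξ₀ ξ) x = (a x).flip (ξ x) + ∫ t in (0 : ℝ)..1,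
      t • ((fderiv ℝ (fun y => (a y).flip (ξ y)) (t • x)).flip x
        - fderiv ℝ (fun y => (a y).flip (ξ y)) (t • x) x) := by
  have hα : ContDiff ℝ 1 fun y => (a y).flip (ξ y) :=
    have h : ContDiff ℝ 1 fun y => (a y).flip := contDiff_clm_flip.comp ha
    h.clm_apply hξ
  have hc := hα.continuous_fderiv one_ne_zero
  have h1 : ∀ x, HasFDerivAt (picardStep a ξ₀ ξ) ((a x).flip (ξ x) + ∫ t in (0 : ℝ)..1,
      t • ((fderiv ℝ (fun y => (a y).flip (ξ y)) (t • x)).flip x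
        - fderiv ℝ (fun y => (a y).flip (ξ y)) (t • x) x)) x := fun x =>
    (hasFDerivAt_radial_integral
      (fun x => (hα.differentiable one_ne_zero x).hasFDerivAt) hc x).const_add ξ₀
  refine ⟨contDiff_one_iff_hasFDerivAt.2 ⟨_, ?_, h1⟩, fun x => (h1 x).fderiv⟩
  refine hα.continuous.add
    (intervalIntegral.continuous_parametric_intervalIntegral_of_continuous' ?_ _ _)
  have hflip : Continuous fun p : E × ℝ =>
      (fderiv ℝ (fun y => (a y).flip (ξ y)) (p.2 • p.1)).flip :=
    (ContinuousLinearMap.flipₗᵢ ℝ E E G).continuous.comp (by fun_prop)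
  show Continuous fun p : E × ℝ =>
    p.2 • ((fderiv ℝ (fun y => (a y).flip (ξ y)) (p.2 • p.1)).flip p.1
      - fderiv ℝ (fun y => (a y).flip (ξ y)) (p.2 • p.1) p.1)
  fun_prop

/-- The connection form `a` (for the equation `dξ = a ξ`) is flat at `x`. -/
def IsFlatAt (a : E → E →L[ℝ] G →L[ℝ] G) (x : E) : Prop :=
  ∀ u v, fderiv ℝ a x u v + a x v * a x u = fderiv ℝ a x v u + a x u * a x v

omit [FiniteDimensional ℝ E] in
/-- For a flat connection form, the curl of `a ξ` is linear in the defect `dξ - a ξ`. -/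
theorem curl_eq_of_isFlatAt {a : E → E →L[ℝ] G →L[ℝ] G} {ξ : E → G} {x : E}
    (ha : DifferentiableAt ℝ a x) (hξ : DifferentiableAt ℝ ξ x) (hflat : IsFlatAt a x) (u v : E) :
    fderiv ℝ (fun y => (a y).flip (ξ y)) x u v - fderiv ℝ (fun y => (a y).flip (ξ y)) x v u
      = a x v ((fderiv ℝ ξ x - (a x).flip (ξ x)) u)
        - a x u ((fderiv ℝ ξ x - (a x).flip (ξ x)) v) := by
  have h := congrArg (fun T : G →L[ℝ] G => T (ξ x)) (hflat u v)
  simp only [_root_.add_apply, mul_apply_eq_comp] at h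
  rw [fderiv_flip_apply ha hξ, fderiv_flip_apply ha hξ]
  simp only [_root_.sub_apply, ContinuousLinearMap.flip_apply, map_sub]
  rw [← sub_eq_zero] at h ⊢
  rw [← h]
  abel

section Estimates

variable [CompleteSpace G] {a : E → E →L[ℝ] G →L[ℝ] G} {r C : ℝ}

omit [FiniteDimensional ℝ E] in
theorem smul_mem_ball_zero {x : E} (hx : x ∈ Metric.ball (0 : E) r) {t : ℝ}
    (ht : t ∈ Ioc (0 : ℝ) 1) : t • x ∈ Metric.ball (0 : E) r := by
  rw [mem_ball_zero_iff] at hx ⊢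
  rw [norm_smul, Real.norm_of_nonneg ht.1.le]
  nlinarith [ht.2, norm_nonneg x]

/-- For a flat connection form, a Picard step contracts the defect `dξ - a ξ`, up to the change
of `ξ`. -/
theorem norm_fderiv_picardStep_sub_le (ha : ContDiff ℝ 1 a)
    (hC : ∀ x ∈ Metric.ball (0 : E) r, ‖a x‖ ≤ C) (hCr : C * r ≤ 1 / 8)
    (hflat : ∀ x ∈ Metric.ball (0 : E) r, IsFlatAt a x)
    (ξ₀ : G) {ξ : E → G} (hξ : ContDiff ℝ 1 ξ) {c : ℝ}
    (hc : ∀ x ∈ Metric.ball (0 : E) r, ‖fderiv ℝ ξ x - (a x).flip (ξ x)‖ ≤ c)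
    {x : E} (hx : x ∈ Metric.ball (0 : E) r) :
    ‖fderiv ℝ (picardStep a ξ₀ ξ) x - (a x).flip (ξ x)‖ ≤ c / 4 := by
  rw [(contDiff_picardStep ha ξ₀ hξ).2, add_sub_cancel_left]
  have hc0 : 0 ≤ c := (norm_nonneg _).trans (hc x hx)
  refine (intervalIntegral.norm_integral_le_of_norm_le_const (C := c / 4) fun t ht => ?_).trans
    (by simp)
  rw [uIoc_of_le zero_le_one] at ht
  have htx := smul_mem_ball_zero hx ht
  have hC0 : 0 ≤ C := (norm_nonneg (a x)).trans (hC x hx)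
  refine ContinuousLinearMap.opNorm_le_bound _ (by positivity) fun v => ?_
  rw [_root_.smul_apply, _root_.sub_apply, ContinuousLinearMap.flip_apply,
    curl_eq_of_isFlatAt (ha.differentiable one_ne_zero _) (hξ.differentiable one_ne_zero _)
      (hflat _ htx), norm_smul, Real.norm_of_nonneg ht.1.le]
  set η := fderiv ℝ ξ (t • x) - (a (t • x)).flip (ξ (t • x)) with hη
  have hηc : ‖η‖ ≤ c := hc _ htx
  have hxr : ‖x‖ ≤ r := (mem_ball_zero_iff.1 hx).le
  have key : ∀ u w : E, ‖a (t • x) u (η w)‖ ≤ C * ‖u‖ * (c * ‖w‖) := fun u w =>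
    calc ‖a (t • x) u (η w)‖ ≤ ‖a (t • x)‖ * ‖u‖ * ‖η w‖ := (a (t • x)).le_opNorm₂ _ _
      _ ≤ C * ‖u‖ * (c * ‖w‖) := by
        gcongr
        · exact hC _ htx
        · exact η.le_of_opNorm_le hηc w
  have h1 := norm_sub_le (a (t • x) x (η v)) (a (t • x) v (η x))
  have h2 := key x v
  have h3 := key v x
  have h4 : C * ‖x‖ * (c * ‖v‖) ≤ 1 / 8 * (c * ‖v‖) := by
    gcongr
    exact (mul_le_mul_of_nonneg_left hxr hC0).trans hCr
  have h5 : ‖a (t • x) x (η v) - a (t • x) v (η x)‖ ≤ c / 4 * ‖v‖ := by nlinarith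
  calc _ ≤ 1 * ‖a (t • x) x (η v) - a (t • x) v (η x)‖ := by gcongr; exact ht.2
    _ ≤ _ := by rw [one_mul]; exact h5

omit [FiniteDimensional ℝ E] [CompleteSpace G] in
theorem norm_picardStep_sub_le (ha : Continuous a)
    (hC : ∀ x ∈ Metric.ball (0 : E) r, ‖a x‖ ≤ C) (hCr : C * r ≤ 1 / 8)
    (ξ₀ : G) {ξ ζ : E → G} (hξ : Continuous ξ) (hζ : Continuous ζ) {c : ℝ}
    (hc : ∀ x ∈ Metric.ball (0 : E) r, ‖ξ x - ζ x‖ ≤ c)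
    {x : E} (hx : x ∈ Metric.ball (0 : E) r) :
    ‖picardStep a ξ₀ ξ x - picardStep a ξ₀ ζ x‖ ≤ c / 2 := by
  have hc0 : 0 ≤ c := (norm_nonneg _).trans (hc x hx)
  have hC0 : 0 ≤ C := (norm_nonneg (a x)).trans (hC x hx)
  unfold picardStep
  rw [add_sub_add_left_eq_sub, ← intervalIntegral.integral_sub]
  rotate_left
  · exact Continuous.intervalIntegrable (by fun_prop) _ _
  · exact Continuous.intervalIntegrable (by fun_prop) _ _
  refine (intervalIntegral.norm_integral_le_of_norm_le_const (C := c / 2) fun t ht => ?_).trans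
    (by simp)
  rw [uIoc_of_le zero_le_one] at ht
  have htx := smul_mem_ball_zero hx ht
  rw [← map_sub]
  have hxr : ‖x‖ ≤ r := (mem_ball_zero_iff.1 hx).le
  calc _ ≤ ‖a (t • x)‖ * ‖x‖ * ‖ξ (t • x) - ζ (t • x)‖ := (a (t • x)).le_opNorm₂ _ _
    _ ≤ C * r * c := by
      have hr0 : 0 ≤ r := (norm_nonneg x).trans hxr
      gcongr
      · exact hC _ htx
      · exact hc _ htx
    _ ≤ c / 2 := by nlinarith

/-- A flat connection on a trivial bundle over a small ball has a parallel section with any given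
value at the centre. -/
theorem exists_parallel_of_isFlatAt_ball (ha : ContDiff ℝ 1 a)
    (hr : 0 < r)
    (hC : ∀ x ∈ Metric.ball (0 : E) r, ‖a x‖ ≤ C) (hCr : C * r ≤ 1 / 8)
    (hflat : ∀ x ∈ Metric.ball (0 : E) r, IsFlatAt a x) (ξ₀ : G) :
    ∃ ξ : E → G, ξ 0 = ξ₀ ∧
      ∀ x ∈ Metric.ball (0 : E) r, HasFDerivAt ξ ((a x).flip (ξ x)) x := by
  have hC0 : 0 ≤ C := (norm_nonneg (a 0)).trans (hC 0 (Metric.mem_ball_self hr))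
  set s : ℕ → E → G := fun k => (picardStep a ξ₀)^[k] fun _ => ξ₀ with hs
  have hs1 : ∀ k, s (k + 1) = picardStep a ξ₀ (s k) := fun k =>
    Function.iterate_succ_apply' _ _ _
  have hs0 : s 0 = fun _ => ξ₀ := rfl
  have hsC : ∀ k, ContDiff ℝ 1 (s k) := by
    intro k
    induction k with
    | zero => exact contDiff_const
    | succ k ih => rw [hs1]; exact (contDiff_picardStep ha ξ₀ ih).1
  have hsat : ∀ k, s k 0 = ξ₀ := by
    intro k
    cases k with
    | zero => rfl
    | succ k => rw [hs1]; simp [picardStep]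
  have hd : ∀ k, ∀ x ∈ Metric.ball (0 : E) r, ‖s (k + 1) x - s k x‖ ≤ ‖ξ₀‖ / 2 * (1 / 2) ^ k := by
    intro k
    induction k with
    | zero =>
      intro x hx
      have h0 : s 0 x = picardStep a ξ₀ (fun _ => 0) x := by simp [picardStep, hs0]
      rw [hs1, h0]
      refine (norm_picardStep_sub_le ha.continuous hC hCr ξ₀ (hsC 0).continuous continuous_const
        (c := ‖ξ₀‖) (fun y _ => by simp [hs0]) hx).trans (by simp)
    | succ k ih =>
      intro x hx
      rw [hs1 (k + 1), hs1 k]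
      rw [pow_succ, ← mul_assoc, mul_one_div]
      refine norm_picardStep_sub_le ha.continuous hC hCr ξ₀
        (contDiff_picardStep ha ξ₀ (hsC k)).1.continuous (hsC k).continuous (fun y hy => ?_) hx
      rw [← hs1 k]
      exact ih y hy
  -- The steps `s (k + 1) - s k` shrink by the factor `1 / 2` and enter the defect with the factor `C`,
  -- while the defect itself shrinks by `1 / 4`: its bound halves if it starts at `2 * C * ‖ξ₀‖`.
  have hη : ∀ k, ∀ x ∈ Metric.ball (0 : E) r,
      ‖fderiv ℝ (s k) x - (a x).flip (s k x)‖ ≤ 2 * C * ‖ξ₀‖ * (1 / 2) ^ k := by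
    intro k
    induction k with
    | zero =>
      intro x hx
      rw [hs0]
      simp only [fderiv_fun_const, Pi.zero_apply, zero_sub, norm_neg, pow_zero, mul_one]
      calc _ ≤ ‖(a x).flip‖ * ‖ξ₀‖ := (a x).flip.le_opNorm _
        _ = ‖a x‖ * ‖ξ₀‖ := by rw [ContinuousLinearMap.opNorm_flip]
        _ ≤ C * ‖ξ₀‖ := by gcongr; exact hC x hx
        _ ≤ _ := by nlinarith [norm_nonneg ξ₀, mul_nonneg hC0 (norm_nonneg ξ₀)]
    | succ k ih =>
      intro x hx
      have h1 := norm_fderiv_picardStep_sub_le ha hC hCr hflat ξ₀ (hsC k) ih hx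
      rw [← hs1] at h1
      have h2 : fderiv ℝ (s (k + 1)) x - (a x).flip (s (k + 1) x)
          = (fderiv ℝ (s (k + 1)) x - (a x).flip (s k x)) - (a x).flip (s (k + 1) x - s k x) := by
        rw [map_sub]; abel
      have h3 : ‖(a x).flip (s (k + 1) x - s k x)‖ ≤ C * (‖ξ₀‖ / 2 * (1 / 2) ^ k) :=
        calc _ ≤ ‖(a x).flip‖ * ‖s (k + 1) x - s k x‖ := (a x).flip.le_opNorm _
          _ = ‖a x‖ * ‖s (k + 1) x - s k x‖ := by rw [ContinuousLinearMap.opNorm_flip]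
          _ ≤ _ := by
            gcongr
            · exact hC x hx
            · exact hd k x hx
      rw [h2]
      refine (norm_sub_le _ _).trans ((add_le_add h1 h3).trans_eq ?_)
      ring
  have hlim : ∀ x ∈ Metric.ball (0 : E) r, ∃ l, Tendsto (fun k => s k x) atTop (𝓝 l) := by
    intro x hx
    refine cauchySeq_tendsto_of_complete (cauchySeq_of_le_geometric (1 / 2) (‖ξ₀‖ / 2)
      (by norm_num) fun k => ?_)
    rw [dist_comm, dist_eq_norm]
    exact hd k x hx
  choose! ξ hξ using hlim
  have hdist : ∀ k, ∀ x ∈ Metric.ball (0 : E) r, ‖s k x - ξ x‖ ≤ ‖ξ₀‖ * (1 / 2) ^ k := by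
    intro k x hx
    have := dist_le_of_le_geometric_of_tendsto (1 / 2) (‖ξ₀‖ / 2) (by norm_num)
      (fun k => by rw [dist_comm, dist_eq_norm]; exact hd k x hx) (hξ x hx) k
    rw [dist_eq_norm] at this
    refine this.trans_eq ?_
    ring
  refine ⟨ξ, ?_, ?_⟩
  · have h0 := hξ 0 (Metric.mem_ball_self hr)
    simp only [hsat] at h0
    exact tendsto_nhds_unique h0 tendsto_const_nhds
  intro x hx
  refine hasFDerivAt_of_tendstoUniformlyOn (f := s) (l := atTop)
    (g' := fun x => (a x).flip (ξ x)) Metric.isOpen_ball ?_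
    (fun k x _ => ((hsC k).differentiable one_ne_zero x).hasFDerivAt) hξ hx
  rw [Metric.tendstoUniformlyOn_iff]
  intro ε hε
  have hpow : Tendsto (fun k : ℕ => 3 * C * ‖ξ₀‖ * (1 / 2 : ℝ) ^ k) atTop (𝓝 0) := by
    simpa using (tendsto_pow_atTop_nhds_zero_of_lt_one (r := (1 / 2 : ℝ)) (by norm_num)
      (by norm_num)).const_mul (3 * C * ‖ξ₀‖)
  filter_upwards [hpow.eventually (gt_mem_nhds hε)] with k hk x hx
  rw [dist_comm, dist_eq_norm]
  have h2 : fderiv ℝ (s k) x - (a x).flip (ξ x)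
      = (fderiv ℝ (s k) x - (a x).flip (s k x)) + (a x).flip (s k x - ξ x) := by
    rw [map_sub]; abel
  have h3 : ‖(a x).flip (s k x - ξ x)‖ ≤ C * (‖ξ₀‖ * (1 / 2) ^ k) :=
    calc _ ≤ ‖(a x).flip‖ * ‖s k x - ξ x‖ := (a x).flip.le_opNorm _
      _ = ‖a x‖ * ‖s k x - ξ x‖ := by rw [ContinuousLinearMap.opNorm_flip]
      _ ≤ _ := by
        gcongr
        · exact hC x hx
        · exact hdist k x hx
  rw [h2]
  refine ((norm_add_le _ _).trans ((add_le_add (hη k x hx) h3).trans_eq ?_)).trans_lt hk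
  ring

end Estimates

omit [FiniteDimensional ℝ E] in
/-- Solutions of `dξ = a ξ` are as smooth as the connection form `a`. -/
theorem contDiffOn_of_hasFDerivAt_flip {a : E → E →L[ℝ] G →L[ℝ] G} {ξ : E → G} {s : Set E}
    (hs : IsOpen s) (ha : ContDiffOn ℝ ∞ a s)
    (hξ : ∀ x ∈ s, HasFDerivAt ξ ((a x).flip (ξ x)) x) : ContDiffOn ℝ ∞ ξ s := by
  have hd : DifferentiableOn ℝ ξ s := fun x hx => (hξ x hx).differentiableAt.differentiableWithinAt
  rw [contDiffOn_infty]
  intro k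
  induction k with
  | zero => exact contDiffOn_zero.2 hd.continuousOn
  | succ k ih =>
    rw [Nat.cast_add, Nat.cast_one, contDiffOn_succ_iff_fderiv_of_isOpen hs]
    refine ⟨hd, fun h => absurd h (by simp), ?_⟩
    have h1 : ContDiffOn ℝ k (fun x => (a x).flip) s :=
      contDiff_clm_flip.comp_contDiffOn (ha.of_le (by exact_mod_cast le_top))
    exact (h1.clm_apply ih).congr fun x hx => (hξ x hx).fderiv

/-- Up to a translation, a map that is smooth near `x₀` agrees near `x₀` with a map that is
continuously differentiable everywhere. -/
theorem exists_contDiff_eq_translate {H : Type*} [NormedAddCommGroup H] [NormedSpace ℝ H]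
    {f : E → H} {R : Set E} (hR : IsOpen R) (hf : ContDiffOn ℝ ∞ f R) {x₀ : E} (hx₀ : x₀ ∈ R) :
    ∃ b : E → H, ContDiff ℝ 1 b ∧ ∃ ε > 0, ∀ y ∈ Metric.ball (0 : E) ε,
      x₀ + y ∈ R ∧ b y = f (x₀ + y) ∧ fderiv ℝ b y = fderiv ℝ f (x₀ + y) := by
  obtain ⟨ε, hε, hεR⟩ := Metric.nhds_basis_closedBall.mem_iff.1 (hR.mem_nhds hx₀)
  let χ : ContDiffBump (0 : E) := ⟨ε / 2, ε, by positivity, by linarith⟩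
  have hmem : ∀ y ∈ Metric.closedBall (0 : E) ε, x₀ + y ∈ R := fun y hy => hεR (by
    simpa [dist_eq_norm] using hy)
  have hshift : ∀ y ∈ Metric.closedBall (0 : E) ε, ContDiffAt ℝ 1 (fun y => f (x₀ + y)) y := by
    intro y hy
    have h1 : ContDiffAt ℝ 1 f (x₀ + y) :=
      (hf.contDiffAt (hR.mem_nhds (hmem y hy))).of_le (by exact_mod_cast le_top)
    exact h1.comp y (contDiffAt_const.add contDiffAt_id)
  have hbeq : ∀ y ∈ Metric.ball (0 : E) (ε / 2),
      (fun y => χ y • f (x₀ + y)) =ᶠ[𝓝 y] fun y => f (x₀ + y) := by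
    intro y hy
    filter_upwards [Metric.isOpen_ball.mem_nhds hy] with z hz
    rw [χ.one_of_mem_closedBall (Metric.ball_subset_closedBall hz), one_smul]
  refine ⟨fun y => χ y • f (x₀ + y), contDiff_iff_contDiffAt.2 fun y => ?_, ε / 2, by positivity,
    fun y hy => ⟨hmem y ?_, (hbeq y hy).eq_of_nhds, ?_⟩⟩
  · by_cases hy : y ∈ tsupport χ
    · rw [χ.tsupport_eq] at hy
      exact χ.contDiffAt.smul (hshift y hy)
    · refine (contDiffAt_const (c := (0 : H))).congr_of_eventuallyEq ?_
      filter_upwards [notMem_tsupport_iff_eventuallyEq.1 hy] with z hz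
      simp only [hz, Pi.zero_apply, zero_smul]
  · exact Metric.closedBall_subset_closedBall (by linarith) (Metric.ball_subset_closedBall hy)
  · rw [(hbeq y hy).fderiv_eq, fderiv_comp_add_left]

/-- A flat connection on a trivial bundle has local parallel sections with arbitrary values at a
given point. -/
theorem exists_parallel_of_isFlatAt [CompleteSpace G] {a : E → E →L[ℝ] G →L[ℝ] G} {R : Set E}
    (hR : IsOpen R) (ha : ContDiffOn ℝ ∞ a R) (hflat : ∀ x ∈ R, IsFlatAt a x) {x₀ : E}
    (hx₀ : x₀ ∈ R) :
    ∃ r > 0, Metric.ball x₀ r ⊆ R ∧ ∀ ξ₀ : G, ∃ ξ : E → G, ξ x₀ = ξ₀ ∧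
      ContDiffOn ℝ ∞ ξ (Metric.ball x₀ r) ∧
      ∀ x ∈ Metric.ball x₀ r, HasFDerivAt ξ ((a x).flip (ξ x)) x := by
  obtain ⟨b, hb, ε, hε, hbε⟩ := exists_contDiff_eq_translate (H := E →L[ℝ] G →L[ℝ] G) hR ha hx₀
  obtain ⟨C, hC⟩ := IsCompact.exists_bound_of_continuousOn (E := E →L[ℝ] G →L[ℝ] G)
    (isCompact_closedBall (0 : E) ε) hb.continuous.continuousOn
  have hC0 : 0 ≤ C := (norm_nonneg (b 0)).trans (hC 0 (Metric.mem_closedBall_self hε.le))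
  set r := min ε (1 / (8 * (C + 1))) with hr
  have hr0 : 0 < r := by positivity
  have hrε : r ≤ ε := min_le_left _ _
  have hCr : C * r ≤ 1 / 8 := by
    calc C * r ≤ (C + 1) * (1 / (8 * (C + 1))) := by
          gcongr
          · linarith
          · exact min_le_right _ _
      _ = 1 / 8 := by field_simp
  have hball : ∀ y ∈ Metric.ball (0 : E) r, y ∈ Metric.ball (0 : E) ε := fun y hy =>
    Metric.ball_subset_ball hrε hy
  have hball' : ∀ y ∈ Metric.ball (0 : E) r, y ∈ Metric.closedBall (0 : E) ε := fun y hy =>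
    Metric.ball_subset_closedBall (hball y hy)
  have hbflat : ∀ y ∈ Metric.ball (0 : E) r, IsFlatAt b y := by
    intro y hy u v
    obtain ⟨h1, h2, h3⟩ := hbε y (hball y hy)
    rw [h2, h3]
    exact hflat _ h1 u v
  have hsub : ∀ x ∈ Metric.ball x₀ r, x - x₀ ∈ Metric.ball (0 : E) r := fun x hx => by
    simpa [dist_eq_norm] using hx
  have hballR : Metric.ball x₀ r ⊆ R := fun x hx => by
    simpa using (hbε _ (hball _ (hsub x hx))).1
  refine ⟨r, hr0, hballR, fun ξ₀ => ?_⟩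
  obtain ⟨ζ, hζ0, hζ⟩ := exists_parallel_of_isFlatAt_ball hb hr0
    (fun y hy => hC y (hball' y hy)) hCr hbflat ξ₀
  have hder : ∀ x ∈ Metric.ball x₀ r,
      HasFDerivAt (fun x => ζ (x - x₀)) ((a x).flip (ζ (x - x₀))) x := by
    intro x hx
    have h1 := hζ _ (hsub x hx)
    rw [(hbε _ (hball _ (hsub x hx))).2.1, add_sub_cancel] at h1
    exact h1.comp x ((hasFDerivAt_id x).sub_const x₀)
  exact ⟨fun x => ζ (x - x₀), by simpa using hζ0,
    contDiffOn_of_hasFDerivAt_flip Metric.isOpen_ball (ha.mono hballR) hder, hder⟩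

end FlatConnection

/-! ### Connections induced by projectors -/

section Projector

variable {E A : Type*} [NormedAddCommGroup E] [NormedSpace ℝ E]
  [NormedRing A] [NormedAlgebra ℝ A]

theorem fderiv_mul_apply {f g : E → A} {x : E} (hf : DifferentiableAt ℝ f x)
    (hg : DifferentiableAt ℝ g x) (v : E) :
    fderiv ℝ (fun y => f y * g y) x v = f x * fderiv ℝ g x v + fderiv ℝ f x v * g x := by
  rw [fderiv_fun_mul' hf hg]
  simp

theorem fderiv_fderiv_apply {H : Type*} [NormedAddCommGroup H] [NormedSpace ℝ H] {f : E → H} {x : E}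
    (hf : DifferentiableAt ℝ (fderiv ℝ f) x) (u v : E) :
    fderiv ℝ (fun y => fderiv ℝ f y v) x u = fderiv ℝ (fderiv ℝ f) x u v := by
  rw [fderiv_clm_apply hf (differentiableAt_const v)]
  simp

theorem two_le_infty : (2 : WithTop ℕ∞) ≤ ∞ :=
  WithTop.coe_le_coe.2 (le_top : (2 : ℕ∞) ≤ ⊤)

theorem differentiableAt_fderiv {H : Type*} [NormedAddCommGroup H] [NormedSpace ℝ H] {f : E → H}
    {x : E} (hf : ContDiffAt ℝ ∞ f x) : DifferentiableAt ℝ (fderiv ℝ f) x :=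
  (hf.fderiv_right (m := 1)
    (by rw [one_add_one_eq_two]; exact two_le_infty)).differentiableAt one_ne_zero

theorem fderiv_fderiv_comm {H : Type*} [NormedAddCommGroup H] [NormedSpace ℝ H] {f : E → H} {x : E}
    (hf : ContDiffAt ℝ ∞ f x) (u v : E) :
    fderiv ℝ (fderiv ℝ f) x u v = fderiv ℝ (fderiv ℝ f) x v u := by
  refine hf.isSymmSndFDerivAt ?_ u v
  rw [minSmoothness_of_isRCLikeNormedField]
  exact two_le_infty

/-- The connection that a field `P` of projectors induces on the images of `P` becomes, in the
trivialization `Φ = P P₀ + (1 - P) (1 - P₀)`, the connection form below. It is flat if the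
curvature `P [dP, dP]` of the induced connection vanishes. -/
theorem flat_connectionForm_of_projector {P : E → A} {P₀ : A} {J : E → A} {R : Set E}
    (hR : IsOpen R) (hP : ContDiffOn ℝ ∞ P R) (hidem : ∀ x ∈ R, P x * P x = P x)
    (hP₀ : P₀ * P₀ = P₀)
    (hJl : ∀ x ∈ R, J x * (P x * P₀ + (1 - P x) * (1 - P₀)) = 1)
    (hJr : ∀ x ∈ R, (P x * P₀ + (1 - P x) * (1 - P₀)) * J x = 1)
    (hflat : ∀ x ∈ R, ∀ u v,
      P x * (fderiv ℝ P x u * fderiv ℝ P x v - fderiv ℝ P x v * fderiv ℝ P x u) = 0)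
    {a : E → E →L[ℝ] A} (ha : ContDiffOn ℝ ∞ a R)
    (haP : ∀ x v, a x v = -(J x * P x * fderiv ℝ P x v * P₀)) {x : E} (hx : x ∈ R) (u v : E) :
    fderiv ℝ a x u v + a x v * a x u = fderiv ℝ a x v u + a x u * a x v ∧
      P x * P₀ * a x v = -(P x * fderiv ℝ P x v * P₀) := by
  set Φ : E → A := fun x => P x * P₀ + (1 - P x) * (1 - P₀) with hΦ
  have hxR := hR.mem_nhds hx
  have hPx : ContDiffAt ℝ ∞ P x := hP.contDiffAt hxR
  have hPd : DifferentiableAt ℝ P x := hPx.differentiableAt (by simp)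
  have hPdd : DifferentiableAt ℝ (fderiv ℝ P) x := differentiableAt_fderiv hPx
  have had : DifferentiableAt ℝ a x := (ha.contDiffAt hxR).differentiableAt (by simp)
  have hΦd : DifferentiableAt ℝ Φ x := by fun_prop
  have hJP : ∀ y ∈ R, P₀ * J y = J y * P y := by
    intro y hy
    have h1 : P y * Φ y = Φ y * P₀ := by
      simp only [hΦ]
      have e1 : P y * (P y * P₀ + (1 - P y) * (1 - P₀)) = P y * P y * P₀ +
        (P y - P y * P y) * (1 - P₀) := by noncomm_ring
      have e2 : (P y * P₀ + (1 - P y) * (1 - P₀)) * P₀ = P y * (P₀ * P₀) +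
        (1 - P y) * (P₀ - P₀ * P₀) := by noncomm_ring
      rw [e1, e2, hidem y hy, hP₀]; simp
    calc P₀ * J y = J y * Φ y * P₀ * J y := by rw [hJl y hy, one_mul]
      _ = J y * (Φ y * P₀) * J y := by noncomm_ring
      _ = J y * P y * (Φ y * J y) := by rw [← h1]; noncomm_ring
      _ = J y * P y := by rw [hJr y hy, mul_one]
  have hP₀a : ∀ y ∈ R, ∀ w, P₀ * a y w = a y w := by
    intro y hy w
    rw [haP]
    calc P₀ * -(J y * P y * fderiv ℝ P y w * P₀)
        = -(P₀ * J y * P y * fderiv ℝ P y w * P₀) := by noncomm_ring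
      _ = -(J y * (P y * P y) * fderiv ℝ P y w * P₀) := by rw [hJP y hy]; noncomm_ring
      _ = _ := by rw [hidem y hy]
  have hΦa : ∀ y ∈ R, ∀ w, Φ y * a y w = -(P y * fderiv ℝ P y w * P₀) := by
    intro y hy w
    rw [haP]
    calc Φ y * -(J y * P y * fderiv ℝ P y w * P₀)
        = -(Φ y * J y * P y * fderiv ℝ P y w * P₀) := by noncomm_ring
      _ = _ := by rw [hJr y hy, one_mul]
  have hPΦ : P x * Φ x = Φ x * P₀ := by
    have := hJP x hx
    calc P x * Φ x = Φ x * (J x * P x) * Φ x := by rw [← mul_assoc, hJr x hx, one_mul]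
      _ = Φ x * P₀ * (J x * Φ x) := by rw [← this]; noncomm_ring
      _ = Φ x * P₀ := by rw [hJl x hx, mul_one]
  have hdΦ : ∀ w, fderiv ℝ Φ x w = fderiv ℝ P x w * P₀ - fderiv ℝ P x w * (1 - P₀) := by
    intro w
    have h1 : HasFDerivAt Φ _ x := ((hPd.hasFDerivAt.mul_const' P₀).add
      ((hPd.hasFDerivAt.const_sub 1).mul_const' (1 - P₀)))
    rw [h1.fderiv]
    simp [sub_eq_add_neg]
  have hcov : P x * P₀ * a x v = -(P x * fderiv ℝ P x v * P₀) := by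
    rw [← hΦa x hx v]
    calc P x * P₀ * a x v = P x * P₀ * a x v + (1 - P x) * (a x v - P₀ * a x v) := by
          rw [hP₀a x hx]; simp
      _ = Φ x * a x v := by simp only [hΦ]; noncomm_ring
  refine ⟨?_, hcov⟩
  -- the derivative of the identity `Φ a = - P dP P₀`, projected by `P`
  have key : ∀ s t, Φ x * (fderiv ℝ a x s t - a x s * a x t)
      = -(P x * fderiv ℝ P x s * fderiv ℝ P x t * P₀
        + P x * fderiv ℝ (fderiv ℝ P) x s t * P₀) := by
    intro s t
    have h1 : (fun y => Φ y * a y t) =ᶠ[𝓝 x] fun y => -(P y * fderiv ℝ P y t * P₀) := by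
      filter_upwards [hxR] with y hy using hΦa y hy t
    have hat : DifferentiableAt ℝ (fun y => a y t) x := by fun_prop
    have hPt : DifferentiableAt ℝ (fun y => fderiv ℝ P y t) x := by fun_prop
    have h2 := congrArg (fun L : E →L[ℝ] A => P x * L s) h1.fderiv_eq
    rw [fderiv_mul_apply hΦd hat, hdΦ, fderiv_fun_neg, _root_.neg_apply,
      fderiv_mul_apply (hPd.fun_mul hPt) (differentiableAt_const _), fderiv_mul_apply hPd hPt,
      fderiv_fderiv_apply hPdd, fderiv_clm_apply had (differentiableAt_const t)] at h2
    simp only [fderiv_fun_const, Pi.zero_apply, _root_.zero_apply,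
      ContinuousLinearMap.comp_zero, zero_add, ContinuousLinearMap.flip_apply, mul_zero] at h2
    have h3 : P₀ * fderiv ℝ a x s t = fderiv ℝ a x s t := by
      have h4 : (fun y => P₀ * a y t) =ᶠ[𝓝 x] fun y => a y t := by
        filter_upwards [hxR] with y hy using hP₀a y hy t
      have h5 := congrArg (fun L : E →L[ℝ] A => L s) h4.fderiv_eq
      rw [fderiv_mul_apply (differentiableAt_const _) hat,
        fderiv_clm_apply had (differentiableAt_const t)] at h5
      simpa using h5
    have h6 : P x * (fderiv ℝ P x s * P₀ - fderiv ℝ P x s * (1 - P₀)) * a x t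
        = - (Φ x * (a x s * a x t)) := by
      rw [← mul_assoc, hΦa x hx s]
      calc _ = P x * fderiv ℝ P x s * (P₀ * a x t) -
            P x * fderiv ℝ P x s * (a x t - P₀ * a x t) := by noncomm_ring
        _ = P x * fderiv ℝ P x s * (P₀ * a x t) := by rw [hP₀a x hx]; simp
        _ = _ := by noncomm_ring
    have h7 : P x * (Φ x * fderiv ℝ a x s t) = Φ x * fderiv ℝ a x s t := by
      rw [← mul_assoc, hPΦ, mul_assoc, h3]
    calc Φ x * (fderiv ℝ a x s t - a x s * a x t)
        = P x * (Φ x * fderiv ℝ a x s t)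
          + P x * (fderiv ℝ P x s * P₀ - fderiv ℝ P x s * (1 - P₀)) * a x t := by
          rw [h6, h7]; noncomm_ring
      _ = P x * (Φ x * fderiv ℝ a x s t
          + (fderiv ℝ P x s * P₀ - fderiv ℝ P x s * (1 - P₀)) * a x t) := by noncomm_ring
      _ = _ := by
        rw [h2]
        calc _ = -(P x * P x * fderiv ℝ (fderiv ℝ P) x s t * P₀
              + P x * fderiv ℝ P x s * fderiv ℝ P x t * P₀) := by noncomm_ring
          _ = _ := by rw [hidem x hx]; abel
  have h8 : Φ x * (fderiv ℝ a x u v - a x u * a x v) = Φ x * (fderiv ℝ a x v u - a x v * a x u) := by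
    rw [key, key, fderiv_fderiv_comm hPx u v]
    have h9 := congrArg (· * P₀) (hflat x hx u v)
    simp only [zero_mul] at h9
    rw [← sub_eq_zero]
    calc _ = -(P x * (fderiv ℝ P x u * fderiv ℝ P x v - fderiv ℝ P x v * fderiv ℝ P x u) * P₀) := by
          noncomm_ring
      _ = 0 := by rw [h9, neg_zero]
  have h10 := congrArg (J x * ·) h8
  have hJΦ : J x * Φ x = 1 := hJl x hx
  simp only [← mul_assoc, hJΦ, one_mul] at h10
  rw [sub_eq_sub_iff_add_eq_add] at h10
  exact h10

/-- Around a given point, the connection induced on the images of a field of projectors with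
vanishing curvature is described by a smooth flat connection form on a trivial bundle. -/
theorem exists_flat_connectionForm_of_projector [CompleteSpace A] {P : E → A} {R : Set E}
    (hR : IsOpen R) (hP : ContDiffOn ℝ ∞ P R) (hidem : ∀ x ∈ R, P x * P x = P x)
    (hflat : ∀ x ∈ R, ∀ u v,
      P x * (fderiv ℝ P x u * fderiv ℝ P x v - fderiv ℝ P x v * fderiv ℝ P x u) = 0)
    {x₀ : E} (hx₀ : x₀ ∈ R) :
    ∃ R' ⊆ R, IsOpen R' ∧ x₀ ∈ R' ∧ ∃ a : E → E →L[ℝ] A, ContDiffOn ℝ ∞ a R' ∧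
      ∀ x ∈ R', ∀ u v,
        fderiv ℝ a x u v + a x v * a x u = fderiv ℝ a x v u + a x u * a x v ∧
        P x * P x₀ * a x v = -(P x * fderiv ℝ P x v * P x₀) := by
  set Φ : E → A := fun x => P x * P x₀ + (1 - P x) * (1 - P x₀) with hΦ
  have hΦR : ContDiffOn ℝ ∞ Φ R :=
    (hP.mul contDiffOn_const).add ((contDiffOn_const.sub hP).mul contDiffOn_const)
  have hΦ₀ : Φ x₀ = 1 := by
    have h1 : Φ x₀ = 1 + (P x₀ * P x₀ - P x₀) + (P x₀ * P x₀ - P x₀) := by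
      simp only [hΦ]; noncomm_ring
    rw [h1, hidem x₀ hx₀]; simp
  set R' := R ∩ Φ ⁻¹' {y | IsUnit y} with hR'
  have hRR : R' ⊆ R := inter_subset_left
  have hR'o : IsOpen R' := hΦR.continuousOn.isOpen_inter_preimage hR Units.isOpen
  have hJ : ContDiffOn ℝ ∞ (fun x => Ring.inverse (Φ x)) R' := by
    intro x hx
    obtain ⟨w, hw⟩ := hx.2
    have h1 := contDiffAt_ringInverse ℝ (n := ∞) w
    rw [hw] at h1
    exact h1.comp_contDiffWithinAt x ((hΦR.mono hRR) x hx)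
  let a : E → E →L[ℝ] A := fun x =>
    (ContinuousLinearMap.mulLeftRight ℝ A (-(Ring.inverse (Φ x) * P x)) (P x₀)) ∘L fderiv ℝ P x
  have ha : ContDiffOn ℝ ∞ a R' := by
    have h1 : ContDiffOn ℝ ∞ (fun x => -(Ring.inverse (Φ x) * P x)) R' :=
      (hJ.mul (hP.mono hRR)).neg
    have h2 : ContDiffOn ℝ ∞ (fun x => ContinuousLinearMap.mulLeftRight ℝ A
        (-(Ring.inverse (Φ x) * P x)) (P x₀)) R' :=
      (((ContinuousLinearMap.mulLeftRight ℝ A).contDiff.comp_contDiffOn h1).clm_apply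
        contDiffOn_const)
    exact h2.clm_comp ((hP.mono hRR).fderiv_of_isOpen hR'o (by simp))
  refine ⟨R', hRR, hR'o, ⟨hx₀, ?_⟩, a, ha, fun x hx u v => ?_⟩
  · simp [hΦ₀]
  · refine flat_connectionForm_of_projector (J := fun x => Ring.inverse (Φ x)) hR'o (hP.mono hRR)
      (fun y hy => hidem y (hRR hy)) (hidem x₀ hx₀)
      (fun y hy => Ring.inverse_mul_cancel _ hy.2) (fun y hy => Ring.mul_inverse_cancel _ hy.2)
      (fun y hy => hflat y (hRR hy)) ha (fun y w => ?_) hx u v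
    simp [a]

end Projector

/-- If the curvature of the connection induced on the images of a field `P` of projectors vanishes,
then every vector in the image of `P x₀` extends to a parallel section near `x₀`. -/
theorem exists_parallel_of_projector {E F : Type*} [NormedAddCommGroup E] [NormedSpace ℝ E]
    [FiniteDimensional ℝ E] [NormedAddCommGroup F] [NormedSpace ℝ F] [CompleteSpace F]
    {P : E → F →L[ℝ] F} {R : Set E}
    (hR : IsOpen R) (hP : ContDiffOn ℝ ∞ P R) (hidem : ∀ x ∈ R, P x * P x = P x)
    (hflat : ∀ x ∈ R, ∀ u v,
      P x * (fderiv ℝ P x u * fderiv ℝ P x v - fderiv ℝ P x v * fderiv ℝ P x u) = 0)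
    {x₀ : E} (hx₀ : x₀ ∈ R) :
    ∃ r > 0, Metric.ball x₀ r ⊆ R ∧ ∀ ξ₀ : F, P x₀ ξ₀ = ξ₀ → ∃ ξ : E → F, ξ x₀ = ξ₀ ∧
      ContDiffOn ℝ ∞ ξ (Metric.ball x₀ r) ∧
      ∀ x ∈ Metric.ball x₀ r, P x (ξ x) = ξ x ∧ ∀ v, P x (fderiv ℝ ξ x v) = 0 := by
  obtain ⟨R', hRR, hR', hx₀', a, ha, haf⟩ :=
    exists_flat_connectionForm_of_projector (A := F →L[ℝ] F) hR hP hidem hflat hx₀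
  obtain ⟨r, hr, hrR, h⟩ := exists_parallel_of_isFlatAt (G := F) (a := a) hR' ha
    (fun x hx u v => (haf x hx u v).1) hx₀'
  refine ⟨r, hr, hrR.trans hRR, fun ξ₀ hξ₀ => ?_⟩
  obtain ⟨ζ, hζ₀, hζ, hζd⟩ := h ξ₀
  have hPr := hP.mono (hrR.trans hRR)
  refine ⟨fun x => P x (P x₀ (ζ x)), by simp only [hζ₀, hξ₀],
    hPr.clm_apply (contDiffOn_const.clm_apply hζ), fun x hx => ⟨?_, fun v => ?_⟩⟩
  · exact congrArg (fun T : F →L[ℝ] F => T (P x₀ (ζ x))) (hidem x (hRR (hrR hx)))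
  have hPd : DifferentiableAt ℝ P x :=
    (hP.contDiffAt (hR.mem_nhds (hRR (hrR hx)))).differentiableAt (by simp)
  have h1 : HasFDerivAt (fun x => P x₀ (ζ x)) (P x₀ ∘L (a x).flip (ζ x)) x :=
    (P x₀).hasFDerivAt.comp x (hζd x hx)
  rw [(hPd.hasFDerivAt.clm_apply h1).fderiv]
  have h2 := congrArg (fun T : F →L[ℝ] F => T (ζ x)) (haf x (hrR hx) 0 v).2
  simp only [mul_apply_eq_comp, _root_.neg_apply] at h2
  have h3 := congrArg (fun T : F →L[ℝ] F => T (fderiv ℝ P x v (P x₀ (ζ x)))) (hidem x (hRR (hrR hx)))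
  simp only [mul_apply_eq_comp] at h3
  simp [h3, h2]

section OrthogonalProjection

variable {E F : Type*} [NormedAddCommGroup E] [NormedSpace ℝ E]
  [NormedAddCommGroup F] [InnerProductSpace ℝ F]

/-- The orthogonal projection onto the orthogonal complement of the range of an injective map
depends smoothly on that map. -/
theorem contDiffOn_starProjection_range_orthogonal {H : Type*} [NormedAddCommGroup H]
    [NormedSpace ℝ H] [FiniteDimensional ℝ H] {B : E → H →L[ℝ] F} {R : Set E}
    (hB : ContDiffOn ℝ ∞ B R) (hinj : ∀ x ∈ R, Function.Injective (B x)) :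
    ContDiffOn ℝ ∞ (fun x => ((B x : H →ₗ[ℝ] F).range)ᗮ.starProjection) R := by
  -- With `C u = ⟪u, B ·⟫`, the projection is `1 - B (C B)⁻¹ C`.
  let ι : F →L[ℝ] F →L[ℝ] ℝ := isBoundedBilinearMap_inner.toContinuousLinearMap
  have hι : ∀ u w, ι u w = inner ℝ u w := fun u w => rfl
  let C : E → F →L[ℝ] H →L[ℝ] ℝ := fun x =>
    (ι ∘L B x).flip
  have hC : ∀ x u k, C x u k = inner ℝ (B x k) u := fun x u k => rfl
  have hCs : ContDiffOn ℝ ∞ C R :=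
    contDiff_clm_flip.comp_contDiffOn (contDiffOn_const.clm_comp hB)
  have hinv : ∀ x ∈ R, (C x ∘L B x).IsInvertible := by
    intro x hx
    have h1 : Function.Injective (C x ∘L B x : H →ₗ[ℝ] H →L[ℝ] ℝ) := by
      refine (injective_iff_map_eq_zero _).2 fun k hk => ?_
      have h2 := congrArg (fun T : H →L[ℝ] ℝ => T k) hk
      have h3 : inner ℝ (B x k) (B x k) = (0 : ℝ) := h2
      rw [inner_self_eq_zero] at h3
      exact hinj x hx (by rw [h3, map_zero])
    have h2 : Module.finrank ℝ H = Module.finrank ℝ (H →L[ℝ] ℝ) := by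
      rw [← LinearEquiv.finrank_eq (LinearMap.toContinuousLinearMap (𝕜 := ℝ) (E := H) (F' := ℝ))]
      exact (Subspace.dual_finrank_eq (K := ℝ) (V := H)).symm
    exact ⟨(LinearMap.linearEquivOfInjective _ h1 h2).toContinuousLinearEquiv, by ext; rfl⟩
  have hM : ContDiffOn ℝ ∞ (fun x => (C x ∘L B x).inverse) R := by
    intro x hx
    exact (hinv x hx).contDiffAt_map_inverse.comp_contDiffWithinAt x
      ((hCs.clm_comp hB) x hx)
  refine (contDiffOn_const (c := ContinuousLinearMap.id ℝ F)).sub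
    (hB.clm_comp (hM.clm_comp hCs)) |>.congr fun x hx => ?_
  ext1 u
  refine Submodule.eq_starProjection_of_mem_orthogonal'
    (z := B x ((C x ∘L B x).inverse (C x u))) ?_ ?_ ?_
  · rw [Submodule.mem_orthogonal']
    rintro _ ⟨k, rfl⟩
    have h1 : C x (B x ((C x ∘L B x).inverse (C x u))) = C x u := by
      obtain ⟨e, he⟩ := hinv x hx
      have := e.apply_symm_apply (C x u)
      rw [← he]
      rw [ContinuousLinearMap.inverse_equiv]
      have h5 : C x (B x (e.symm (C x u))) = (C x ∘L B x) (e.symm (C x u)) := rfl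
      rw [← he] at h5
      exact h5.trans this
    have h2 := congrArg (fun T : H →L[ℝ] ℝ => T k) h1
    simp only [hC] at h2
    rw [real_inner_comm] at h2
    simp [inner_sub_left, h2, real_inner_comm]
  · exact Submodule.le_orthogonal_orthogonal _ ⟨_, rfl⟩
  · simp

end OrthogonalProjection

/-! ### The normal bundle of an immersion into the sphere -/

section NormalBundle

variable {E F : Type*} [NormedAddCommGroup E] [NormedSpace ℝ E]
  [NormedAddCommGroup F] [InnerProductSpace ℝ F]

/-- The map `(t, v) ↦ t • g x + dg(x)(v)`, whose range is the orthogonal complement of the normal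
space. -/
noncomputable def coneDifferential (g : E → F) (x : E) : ℝ × E →L[ℝ] F :=
  (ContinuousLinearMap.fst ℝ ℝ E).smulRight (g x) + fderiv ℝ g x ∘L ContinuousLinearMap.snd ℝ ℝ E

theorem coneDifferential_apply (g : E → F) (x : E) (p : ℝ × E) :
    coneDifferential g x p = p.1 • g x + fderiv ℝ g x p.2 := rfl

theorem range_coneDifferential (g : E → F) (x : E) :
    (coneDifferential g x : ℝ × E →ₗ[ℝ] F).range
      = Submodule.span ℝ {g x} ⊔ (fderiv ℝ g x : E →ₗ[ℝ] F).range := by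
  ext u
  rw [Submodule.mem_sup]
  constructor
  · rintro ⟨p, rfl⟩
    exact ⟨p.1 • g x, Submodule.smul_mem _ _ (Submodule.mem_span_singleton_self _),
      fderiv ℝ g x p.2, ⟨p.2, rfl⟩, rfl⟩
  · rintro ⟨y, hy, _, ⟨v, rfl⟩, rfl⟩
    obtain ⟨t, rfl⟩ := Submodule.mem_span_singleton.1 hy
    exact ⟨(t, v), rfl⟩

theorem normalSpace_eq (g : E → F) (x : E) :
    normalSpace g x = ((coneDifferential g x : ℝ × E →ₗ[ℝ] F).range)ᗮ := by
  rw [range_coneDifferential, normalSpace]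

theorem mem_normalSpace_iff {g : E → F} {x : E} {u : F} :
    u ∈ normalSpace g x ↔ inner ℝ (g x) u = 0 ∧ ∀ v, inner ℝ (fderiv ℝ g x v) u = 0 := by
  rw [normalSpace_eq, Submodule.mem_orthogonal]
  constructor
  · intro h
    refine ⟨?_, fun v => ?_⟩
    · simpa [coneDifferential_apply] using h _ ⟨((1 : ℝ), (0 : E)), rfl⟩
    · simpa [coneDifferential_apply] using h _ ⟨((0 : ℝ), v), rfl⟩
  · rintro ⟨h1, h2⟩ _ ⟨p, rfl⟩
    show inner ℝ (coneDifferential g x p) u = 0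
    rw [coneDifferential_apply, inner_add_left, inner_smul_left, h1, h2]
    simp

/-- A map into the unit sphere is orthogonal to its differential. -/
theorem inner_fderiv_eq_zero_of_norm_eq_one {g : E → F} {R : Set E} (hR : IsOpen R)
    (hg : ContDiffOn ℝ ∞ g R) (h1 : ∀ x ∈ R, inner ℝ (g x) (g x) = (1 : ℝ)) {x : E} (hx : x ∈ R)
    (v : E) : inner ℝ (g x) (fderiv ℝ g x v) = 0 := by
  have hd : DifferentiableAt ℝ g x := (hg.contDiffAt (hR.mem_nhds hx)).differentiableAt (by simp)
  have h2 : (fun y => inner ℝ (g y) (g y)) =ᶠ[𝓝 x] fun _ => (1 : ℝ) := by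
    filter_upwards [hR.mem_nhds hx] with y hy using h1 y hy
  have h3 := congrArg (fun L : E →L[ℝ] ℝ => L v) h2.fderiv_eq
  simp only [fderiv_inner_apply ℝ hd hd, fderiv_fun_const, Pi.zero_apply, _root_.zero_apply] at h3
  rw [real_inner_comm] at h3
  linarith [real_inner_comm (fderiv ℝ g x v) (g x)]

theorem injective_coneDifferential {g : E → F} {x : E} (h1 : inner ℝ (g x) (g x) = (1 : ℝ))
    (h2 : ∀ v, inner ℝ (g x) (fderiv ℝ g x v) = 0)
    (h3 : Function.Injective (fderiv ℝ g x)) : Function.Injective (coneDifferential g x) := by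
  refine (injective_iff_map_eq_zero _).2 fun p hp => ?_
  rw [coneDifferential_apply] at hp
  have h4 : p.1 = 0 := by
    have := congrArg (inner ℝ (g x)) hp
    simpa only [inner_add_right, inner_smul_right, h1, h2, inner_zero_right, mul_one,
      add_zero] using this
  rw [h4, zero_smul, zero_add] at hp
  exact Prod.ext h4 (h3 (by rw [hp, Prod.snd_zero, map_zero]))

variable [FiniteDimensional ℝ F]

theorem finrank_normalSpace [FiniteDimensional ℝ E] {g : E → F} {x : E}
    (h : Function.Injective (coneDifferential g x)) :
    1 + Module.finrank ℝ E + Module.finrank ℝ (normalSpace g x) = Module.finrank ℝ F := by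
  rw [normalSpace_eq, ← Submodule.finrank_add_finrank_orthogonal
    (coneDifferential g x : ℝ × E →ₗ[ℝ] F).range, LinearMap.finrank_range_of_inj h,
    Module.finrank_prod, Module.finrank_self]

/-- The normal connection is flat if the normal bundle is spanned by parallel
fields. -/
theorem normalCurvatureZeroOn_of_parallel_frame {κ : Type*} [Fintype κ] {g : E → F} {R : Set E}
    (hR : IsOpen R) {X : κ → E → F} (hX : ∀ k, ContDiffOn ℝ ∞ (X k) R)
    (hon : ∀ x ∈ R, Orthonormal ℝ fun k => X k x)
    (hspan : ∀ x ∈ R, normalSpace g x = Submodule.span ℝ (range fun k => X k x))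
    (hpar : ∀ k, ∀ x ∈ R, ∀ v, normalDeriv g v (X k) x = 0) : NormalCurvatureZeroOn g R := by
  intro ξ hξ hξN v w x hx
  have hderiv : ∀ (b : κ → E → ℝ) (ζ : E → F), (∀ y ∈ R, ζ y = ∑ k, b k y • X k y) →
      ∀ y ∈ R, (∀ k, DifferentiableAt ℝ (b k) y) → ∀ u,
        normalDeriv g u ζ y = ∑ k, fderiv ℝ (b k) y u • X k y := by
    intro b ζ hζ y hy hb u
    have hXd : ∀ k, DifferentiableAt ℝ (X k) y := fun k =>
      ((hX k).contDiffAt (hR.mem_nhds hy)).differentiableAt (by simp)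
    have h1 : ζ =ᶠ[𝓝 y] fun y => ∑ k, b k y • X k y := by
      filter_upwards [hR.mem_nhds hy] with z hz using hζ z hz
    have h2 : HasFDerivAt (fun y => ∑ k, b k y • X k y)
        (∑ k, (b k y • fderiv ℝ (X k) y + (fderiv ℝ (b k) y).smulRight (X k y))) y :=
      HasFDerivAt.fun_sum fun k _ => (hb k).hasFDerivAt.smul (hXd k).hasFDerivAt
    rw [normalDeriv, h1.fderiv_eq, h2.fderiv]
    simp only [_root_.sum_apply, _root_.add_apply, _root_.smul_apply,
      ContinuousLinearMap.smulRight_apply, map_sum, map_add, map_smul]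
    refine Finset.sum_congr rfl fun k _ => ?_
    have h3 := hpar k y hy u
    rw [normalDeriv] at h3
    have h4 : X k y ∈ normalSpace g y := by
      rw [hspan y hy]; exact Submodule.subset_span ⟨k, rfl⟩
    rw [h3, smul_zero, zero_add, Submodule.starProjection_eq_self_iff.2 h4]
  set b : κ → E → ℝ := fun k y => inner ℝ (X k y) (ξ y) with hb
  have hbs : ∀ k, ContDiffOn ℝ ∞ (b k) R := fun k => (hX k).inner ℝ hξ
  have hbd : ∀ k, ∀ y ∈ R, ContDiffAt ℝ ∞ (b k) y := fun k y hy =>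
    (hbs k).contDiffAt (hR.mem_nhds hy)
  have hξb : ∀ y ∈ R, ξ y = ∑ k, b k y • X k y := by
    intro y hy
    have h1 := hξN y hy
    rw [hspan y hy, Submodule.mem_span_range_iff_exists_fun] at h1
    obtain ⟨c, hc⟩ := h1
    have h2 : ∀ k, b k y = c k := fun k => by
      simp only [hb, ← hc]
      exact (hon y hy).inner_right_fintype c k
    simp only [h2, hc]
  have h1 : ∀ u, ∀ y ∈ R, normalDeriv g u ξ y = ∑ k, fderiv ℝ (b k) y u • X k y := fun u y hy =>
    hderiv b ξ hξb y hy (fun k => (hbd k y hy).differentiableAt (by simp)) u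
  have hbdd : ∀ k, DifferentiableAt ℝ (fderiv ℝ (b k)) x := fun k =>
    differentiableAt_fderiv (hbd k x hx)
  have h2 : ∀ s t, normalDeriv g s (normalDeriv g t ξ) x
      = ∑ k, fderiv ℝ (fderiv ℝ (b k)) x s t • X k x := by
    intro s t
    rw [hderiv (fun k y => fderiv ℝ (b k) y t) _ (h1 t) x hx
      (fun k => (hbdd k).clm_apply (differentiableAt_const t)) s]
    simp only [fderiv_fderiv_apply (hbdd _)]
  rw [h2, h2, sub_eq_zero]
  exact Finset.sum_congr rfl fun k _ => by rw [fderiv_fderiv_comm (hbd k x hx)]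

section Parallel

variable {g : E → F} {R : Set E}

theorem IsSphericalImmersionWithFlatNormalBundleOn.inner_self
    (h : IsSphericalImmersionWithFlatNormalBundleOn g R) {x : E} (hx : x ∈ R) :
    inner ℝ (g x) (g x) = (1 : ℝ) := by
  rw [real_inner_self_eq_norm_sq, mem_sphere_zero_iff_norm.1 (h.mem_sphere x hx), one_pow]

theorem IsSphericalImmersionWithFlatNormalBundleOn.injective_coneDifferential
    (h : IsSphericalImmersionWithFlatNormalBundleOn g R) {x : E} (hx : x ∈ R) :
    Function.Injective (coneDifferential g x) :=
  FlatNormal.injective_coneDifferential (h.inner_self hx)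
    (inner_fderiv_eq_zero_of_norm_eq_one h.isOpen h.contDiffOn (fun _ => h.inner_self) hx)
    (h.injective_fderiv x hx)

variable [FiniteDimensional ℝ E]

theorem IsSphericalImmersionWithFlatNormalBundleOn.contDiffOn_starProjection
    (h : IsSphericalImmersionWithFlatNormalBundleOn g R) :
    ContDiffOn ℝ ∞ (fun x => (normalSpace g x).starProjection) R := by
  have hB : ContDiffOn ℝ ∞ (coneDifferential g) R := by
    have h1 : ContDiffOn ℝ ∞ (fun x => (ContinuousLinearMap.fst ℝ ℝ E).smulRight (g x)) R :=
      contDiffOn_const.smulRight h.contDiffOn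
    exact h1.add ((h.contDiffOn.fderiv_of_isOpen h.isOpen (by simp)).clm_comp contDiffOn_const)
  have h2 := contDiffOn_starProjection_range_orthogonal hB
    fun x hx => h.injective_coneDifferential hx
  refine h2.congr fun x _ => ?_
  congr 1
  exact normalSpace_eq g x

/-- Flatness in terms of projections: the curvature of the normal connection is `P [dP, dP]` for the
projection `P` onto the normal space. -/
theorem IsSphericalImmersionWithFlatNormalBundleOn.projection_mul_bracket
    (h : IsSphericalImmersionWithFlatNormalBundleOn g R) {P : E → F →L[ℝ] F}
    (hP : ∀ x, P x = (normalSpace g x).starProjection) {x : E} (hx : x ∈ R) (u v : E) :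
    P x * (fderiv ℝ P x u * fderiv ℝ P x v - fderiv ℝ P x v * fderiv ℝ P x u) = 0 := by
  have hPs : ContDiffOn ℝ ∞ P R := h.contDiffOn_starProjection.congr fun x _ => hP x
  have hPx : ∀ y ∈ R, ContDiffAt ℝ ∞ P y := fun y hy => hPs.contDiffAt (h.isOpen.mem_nhds hy)
  have hPd : ∀ y ∈ R, DifferentiableAt ℝ P y := fun y hy => (hPx y hy).differentiableAt (by simp)
  have hPdd : DifferentiableAt ℝ (fderiv ℝ P) x := differentiableAt_fderiv (hPx x hx)
  ext1 c
  have hN : ∀ t, ∀ y ∈ R, normalDeriv g t (fun z => P z c) y = P y (fderiv ℝ P y t c) := by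
    intro t y hy
    rw [normalDeriv, ← hP, fderiv_clm_apply (hPd y hy) (differentiableAt_const c)]
    simp
  have hNN : ∀ s t, normalDeriv g s (normalDeriv g t fun z => P z c) x
      = P x (fderiv ℝ P x s (fderiv ℝ P x t c)) + P x (P x (fderiv ℝ (fderiv ℝ P) x s t c)) := by
    intro s t
    have h1 : (normalDeriv g t fun z => P z c) =ᶠ[𝓝 x] fun y => P y (fderiv ℝ P y t c) := by
      filter_upwards [h.isOpen.mem_nhds hx] with y hy using hN t y hy
    have h2 : HasFDerivAt (fun y => fderiv ℝ P y t) ((fderiv ℝ (fderiv ℝ P) x).flip t) x := by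
      simpa using hPdd.hasFDerivAt.clm_apply (hasFDerivAt_const t x)
    have h3 := (hPd x hx).hasFDerivAt.clm_apply (h2.clm_apply (hasFDerivAt_const c x))
    rw [normalDeriv, ← hP, h1.fderiv_eq, h3.fderiv]
    simp [add_comm]
  have h4 := h.flat (fun z => P z c) (hPs.clm_apply contDiffOn_const)
    (fun y _ => by rw [hP]; exact Submodule.starProjection_apply_mem _ _) u v x hx
  rw [hNN, hNN, fderiv_fderiv_comm (hPx x hx) u v, add_sub_add_right_eq_sub] at h4
  simpa using h4

/-- An immersion into the sphere with flat normal bundle has parallel normal fields with arbitrary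
values at a given point. -/
theorem IsSphericalImmersionWithFlatNormalBundleOn.exists_parallel
    (h : IsSphericalImmersionWithFlatNormalBundleOn g R) {x₀ : E} (hx₀ : x₀ ∈ R) :
    ∃ r > 0, Metric.ball x₀ r ⊆ R ∧ ∀ ξ₀ ∈ normalSpace g x₀, ∃ ξ : E → F, ξ x₀ = ξ₀ ∧
      ContDiffOn ℝ ∞ ξ (Metric.ball x₀ r) ∧ ∀ x ∈ Metric.ball x₀ r,
        ξ x ∈ normalSpace g x ∧ ∀ v, fderiv ℝ ξ x v ∈ (normalSpace g x)ᗮ := by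
  obtain ⟨r, hr, hrR, hex⟩ := exists_parallel_of_projector h.isOpen h.contDiffOn_starProjection
    (fun x _ => (Submodule.isIdempotentElem_starProjection _).eq)
    (fun x hx u v => h.projection_mul_bracket (fun _ => rfl) hx u v) hx₀
  refine ⟨r, hr, hrR, fun ξ₀ hξ₀ => ?_⟩
  obtain ⟨ξ, h1, h2, h3⟩ := hex ξ₀ (Submodule.starProjection_eq_self_iff.2 hξ₀)
  exact ⟨ξ, h1, h2, fun x hx => ⟨Submodule.starProjection_eq_self_iff.1 (h3 x hx).1,
    fun v => (Submodule.starProjection_apply_eq_zero_iff _).1 ((h3 x hx).2 v)⟩⟩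

end Parallel

end NormalBundle

/-! ### Matrix calculus and the columns of `W` -/

section MatrixCalculus

variable {n : ℕ} {ι κ μ : Type*}

theorem matrixDeriv_mul [Fintype κ] {A : Eucl n → Matrix ι κ ℝ} {B : Eucl n → Matrix κ μ ℝ}
    {x : Eucl n} (hA : ∀ i j, DifferentiableAt ℝ (fun y => A y i j) x)
    (hB : ∀ i j, DifferentiableAt ℝ (fun y => B y i j) x) (v : Eucl n) :
    matrixDeriv (fun y => A y * B y) x v = matrixDeriv A x v * B x + A x * matrixDeriv B x v := by
  ext i j
  have h := HasFDerivAt.fun_sum (u := Finset.univ) fun k _ =>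
    (hA i k).hasFDerivAt.fun_mul (hB k j).hasFDerivAt
  simp only [matrixDeriv, Matrix.of_apply, Matrix.add_apply, Matrix.mul_apply]
  rw [h.fderiv, ← Finset.sum_add_distrib]
  simp only [_root_.sum_apply, _root_.add_apply, _root_.smul_apply, smul_eq_mul]
  exact Finset.sum_congr rfl fun k _ => by ring

theorem matrixDeriv_congr {A B : Eucl n → Matrix ι κ ℝ} {x : Eucl n} (h : A =ᶠ[𝓝 x] B)
    (v : Eucl n) : matrixDeriv A x v = matrixDeriv B x v := by
  ext i j
  have h1 : (fun y => A y i j) =ᶠ[𝓝 x] fun y => B y i j := by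
    filter_upwards [h] with y hy
    rw [hy]
  simp only [matrixDeriv, Matrix.of_apply]
  rw [h1.fderiv_eq]

theorem matrixDeriv_const (A : Matrix ι κ ℝ) (x v : Eucl n) :
    matrixDeriv (fun _ => A) x v = 0 := by
  ext i j
  simp [matrixDeriv]

theorem matrixDeriv_const_sub (C : Matrix ι κ ℝ) (A : Eucl n → Matrix ι κ ℝ) (x v : Eucl n) :
    matrixDeriv (fun y => C - A y) x v = -matrixDeriv A x v := by
  ext i j
  simp [matrixDeriv, fderiv_const_sub]

theorem matrixDeriv_comp {A : Eucl n → Matrix ι κ ℝ} {ψ : Eucl n → Eucl n} {x : Eucl n}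
    (hA : ∀ i j, DifferentiableAt ℝ (fun y => A y i j) (ψ x)) (hψ : DifferentiableAt ℝ ψ x)
    (v : Eucl n) :
    matrixDeriv (fun y => A (ψ y)) x v = matrixDeriv A (ψ x) (fderiv ℝ ψ x v) := by
  ext i j
  have h := ((hA i j).hasFDerivAt.comp x hψ.hasFDerivAt).fderiv
  exact congrArg (fun L : Eucl n →L[ℝ] ℝ => L v) h

/-- The differential of the inverse, in the form `dJ Ω + J dΩ = 0`. -/
theorem matrixDeriv_mul_add_mul_matrixDeriv_of_mul_eq_one [Fintype κ] [DecidableEq κ]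
    {J Ω : Eucl n → Matrix κ κ ℝ} {V : Set (Eucl n)} (hV : IsOpen V)
    (hJ : ∀ i j, ContDiffOn ℝ ∞ (fun y => J y i j) V)
    (hΩ : ∀ i j, ContDiffOn ℝ ∞ (fun y => Ω y i j) V) (h : ∀ x ∈ V, J x * Ω x = 1)
    {x : Eucl n} (hx : x ∈ V) (v : Eucl n) :
    matrixDeriv J x v * Ω x + J x * matrixDeriv Ω x v = 0 := by
  rw [← matrixDeriv_mul
    (fun i j => ((hJ i j).contDiffAt (hV.mem_nhds hx)).differentiableAt (by simp))
    (fun i j => ((hΩ i j).contDiffAt (hV.mem_nhds hx)).differentiableAt (by simp)),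
    matrixDeriv_congr (B := fun _ => 1) (by filter_upwards [hV.mem_nhds hx] with y hy using h y hy),
    matrixDeriv_const]

theorem contDiffOn_matrix_mul [Fintype κ] {A : Eucl n → Matrix ι κ ℝ} {B : Eucl n → Matrix κ μ ℝ}
    {V : Set (Eucl n)} (hA : ∀ i j, ContDiffOn ℝ ∞ (fun y => A y i j) V)
    (hB : ∀ i j, ContDiffOn ℝ ∞ (fun y => B y i j) V) (i : ι) (j : μ) :
    ContDiffOn ℝ ∞ (fun y => (A y * B y) i j) V := by
  simp only [Matrix.mul_apply]
  exact ContDiffOn.sum fun k _ => (hA i k).mul (hB k j)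

theorem contDiffOn_matrix_det [Fintype κ] [DecidableEq κ] {A : Eucl n → Matrix κ κ ℝ}
    {V : Set (Eucl n)} (hA : ∀ i j, ContDiffOn ℝ ∞ (fun y => A y i j) V) :
    ContDiffOn ℝ ∞ (fun y => (A y).det) V := by
  simp only [Matrix.det_apply]
  exact ContDiffOn.sum fun σ _ =>
    (contDiffOn_prod fun k _ => hA (σ k) k).const_smul (Equiv.Perm.sign σ : ℤˣ)

theorem contDiffOn_matrix_inv [Fintype κ] [DecidableEq κ] {A : Eucl n → Matrix κ κ ℝ}
    {V : Set (Eucl n)} (hA : ∀ i j, ContDiffOn ℝ ∞ (fun y => A y i j) V)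
    (hu : ∀ x ∈ V, IsUnit (A x)) (i j : κ) : ContDiffOn ℝ ∞ (fun y => (A y)⁻¹ i j) V := by
  simp only [Matrix.inv_def, Matrix.smul_apply, Matrix.adjugate_apply, Ring.inverse_eq_inv',
    smul_eq_mul]
  refine ((contDiffOn_matrix_det hA).inv fun x hx => ?_).mul (contDiffOn_matrix_det fun k l => ?_)
  · exact ((Matrix.isUnit_iff_isUnit_det _).1 (hu x hx)).ne_zero
  · by_cases hk : k = j
    · simp only [Matrix.updateRow_apply, hk, if_true]
      exact contDiffOn_const
    · simp only [Matrix.updateRow_apply, hk, if_false]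
      exact hA k l

end MatrixCalculus

section FrameAlgebra

variable {ι κ : Type*} [Fintype ι] [Fintype κ] [DecidableEq κ]
  {G G' : Matrix ι κ ℝ} {Ω J Ω' J' : Matrix κ κ ℝ}

/-- The relation `Wᵗ W = 1` for `W` with the blocks `G J` and `1 - J`, where `J = Ω⁻¹`. -/
theorem gram_of_symm (hJ : Ω * J = 1) (hsymm : Ω + Ω.transpose = G.transpose * G + 1) :
    (G * J).transpose * (G * J) + (1 - J).transpose * (1 - J) = 1 := by
  have hG : G.transpose * G = Ω + Ω.transpose - 1 := by rw [hsymm]; abel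
  have hJt : J.transpose * Ω.transpose = 1 := by rw [← Matrix.transpose_mul, hJ, Matrix.transpose_one]
  have h1 : (G * J).transpose * (G * J) = J.transpose * (G.transpose * G) * J := by
    rw [Matrix.transpose_mul]; simp only [Matrix.mul_assoc]
  rw [h1, hG, Matrix.transpose_sub, Matrix.transpose_one]
  calc _ = J.transpose * (Ω * J) + (J.transpose * Ω.transpose) * J - J.transpose
        + 1 - J := by noncomm_ring
    _ = 1 := by rw [hJ, hJt]; noncomm_ring

/-- The relation `Wᵗ dW = 0` for `W` with the blocks `G J` and `1 - J`, where `J = Ω⁻¹`; primes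
stand for derivatives in a fixed direction. -/
theorem deriv_gram_of_symm (hJ : Ω * J = 1) (hJ' : J' * Ω + J * Ω' = 0)
    (hsymm : Ω + Ω.transpose = G.transpose * G + 1) (hd : Ω' = G.transpose * G') :
    (G * J).transpose * (G' * J + G * J') + (1 - J).transpose * -J' = 0 := by
  have hG : G.transpose * G = Ω + Ω.transpose - 1 := by rw [hsymm]; abel
  have hJt : J.transpose * Ω.transpose = 1 := by rw [← Matrix.transpose_mul, hJ, Matrix.transpose_one]
  have hJl : J * Ω = 1 := mul_eq_one_comm.1 hJ
  have h1 : (G * J).transpose * (G' * J + G * J')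
      = J.transpose * (G.transpose * G') * J + J.transpose * (G.transpose * G) * J' := by
    rw [Matrix.transpose_mul, Matrix.mul_add]; simp only [Matrix.mul_assoc]
  have h2 : Ω' * J + Ω * J' = 0 := by
    calc Ω' * J + Ω * J' = (Ω * J) * Ω' * J + Ω * J' * (Ω * J) := by rw [hJ]; simp
      _ = Ω * (J' * Ω + J * Ω') * J := by noncomm_ring
      _ = 0 := by rw [hJ']; simp
  rw [h1, hG, ← hd, Matrix.transpose_sub, Matrix.transpose_one]
  calc _ = J.transpose * (Ω' * J + Ω * J') + (J.transpose * Ω.transpose - 1) * J' := by noncomm_ring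
    _ = 0 := by rw [h2, hJt]; simp

variable {A A' : Matrix ι κ ℝ} {D D' : Matrix κ κ ℝ}

/-- The converse of `gram_of_symm`, for `W` with the blocks `A` and `1 - D`, where `Ω = D⁻¹` and
`G = A Ω`. -/
theorem symm_of_gram (hD : Ω * D = 1)
    (hW : A.transpose * A + (1 - D).transpose * (1 - D) = 1) :
    Ω + Ω.transpose = (A * Ω).transpose * (A * Ω) + 1 := by
  have hDr : D * Ω = 1 := mul_eq_one_comm.1 hD
  have hDt : Ω.transpose * D.transpose = 1 := by
    rw [← Matrix.transpose_mul, hDr, Matrix.transpose_one]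
  have hA : A.transpose * A = 1 - (1 - D.transpose) * (1 - D) := by
    rw [Matrix.transpose_sub, Matrix.transpose_one] at hW
    exact eq_sub_of_add_eq hW
  have h1 : (A * Ω).transpose * (A * Ω) = Ω.transpose * (A.transpose * A) * Ω := by
    rw [Matrix.transpose_mul]; simp only [Matrix.mul_assoc]
  rw [h1, hA]
  calc Ω + Ω.transpose = Ω.transpose * (D * Ω) + (Ω.transpose * D.transpose) * Ω
        - (Ω.transpose * D.transpose) * (D * Ω) + 1 := by rw [hDr, hDt]; noncomm_ring
    _ = _ := by noncomm_ring

/-- The converse of `deriv_gram_of_symm`, for `W` with the blocks `A` and `1 - D`, where `Ω = D⁻¹`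
and `G = A Ω`. -/
theorem deriv_of_gram (hD : Ω * D = 1) (hD' : Ω' * D + Ω * D' = 0)
    (hW : A.transpose * A + (1 - D).transpose * (1 - D) = 1)
    (hW' : A.transpose * A' + (1 - D).transpose * -D' = 0) :
    Ω' = (A * Ω).transpose * (A' * Ω + A * Ω') := by
  have hDr : D * Ω = 1 := mul_eq_one_comm.1 hD
  have hDt : Ω.transpose * D.transpose = 1 := by
    rw [← Matrix.transpose_mul, hDr, Matrix.transpose_one]
  have hA : A.transpose * A = 1 - (1 - D.transpose) * (1 - D) := by
    rw [Matrix.transpose_sub, Matrix.transpose_one] at hW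
    exact eq_sub_of_add_eq hW
  have hA' : A.transpose * A' = (1 - D.transpose) * D' := by
    rw [Matrix.transpose_sub, Matrix.transpose_one] at hW'
    rw [← sub_eq_zero, ← hW']; noncomm_ring
  have h1 : (A * Ω).transpose * (A' * Ω + A * Ω')
      = Ω.transpose * (A.transpose * A') * Ω + Ω.transpose * (A.transpose * A) * Ω' := by
    rw [Matrix.transpose_mul, Matrix.mul_add]; simp only [Matrix.mul_assoc]
  have h2 : D' * Ω + D * Ω' = 0 := by
    calc D' * Ω + D * Ω' = (D * Ω) * D' * Ω + D * Ω' * (D * Ω) := by rw [hDr]; simp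
      _ = D * (Ω' * D + Ω * D') * Ω := by noncomm_ring
      _ = 0 := by rw [hD']; simp
  rw [h1, hA, hA']
  symm
  calc _ = Ω.transpose * (D' * Ω + D * Ω') - (Ω.transpose * D.transpose) * (D' * Ω + D * Ω')
        + (Ω.transpose * D.transpose) * Ω' := by noncomm_ring
    _ = Ω' := by rw [h2, hDt]; simp

end FrameAlgebra

section Frame

variable {E F : Type*} [NormedAddCommGroup E] [NormedSpace ℝ E] [FiniteDimensional ℝ E]
  [NormedAddCommGroup F] [InnerProductSpace ℝ F] [FiniteDimensional ℝ F]

/-- If the vectors `X k` form an orthonormal frame whose differentials are orthogonal to all of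
them, and if the rank of the frame is complementary to the dimension of the domain, then each `X j`
is an immersion into the sphere with flat normal bundle: the other members of the frame are parallel
normal fields. -/
theorem isSphericalImmersionWithFlatNormalBundleOn_of_frame {κ : Type*} [Fintype κ]
    {X : κ → E → F} {V : Set E} (hV : IsOpen V) (hX : ∀ k, ContDiffOn ℝ ∞ (X k) V)
    (hon : ∀ x ∈ V, Orthonormal ℝ fun k => X k x)
    (hd : ∀ i k, ∀ x ∈ V, ∀ v, inner ℝ (X i x) (fderiv ℝ (X k) x v) = 0)
    (hrank : Module.finrank ℝ F = Module.finrank ℝ E + Fintype.card κ) (j : κ) :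
    IsSphericalImmersionWithFlatNormalBundleOn (X j)
      {x | x ∈ V ∧ Function.Injective (fderiv ℝ (X j) x)} := by
  classical
  set R := {x | x ∈ V ∧ Function.Injective (fderiv ℝ (X j) x)}
  have hRV : R ⊆ V := fun x hx => hx.1
  have hRo : IsOpen R := by
    have h1 : ContinuousOn (fderiv ℝ (X j)) V :=
      (hX j).continuousOn_fderiv_of_isOpen hV (by simp)
    exact h1.isOpen_inter_preimage hV ContinuousLinearMap.isOpen_injective
  have h11 : ∀ x ∈ R, inner ℝ (X j x) (X j x) = (1 : ℝ) := fun x hx => by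
    rw [real_inner_self_eq_norm_sq, (hon x hx.1).1 j, one_pow]
  have hmem : ∀ k, k ≠ j → ∀ x ∈ R, X k x ∈ normalSpace (X j) x := fun k hk x hx =>
    mem_normalSpace_iff.2 ⟨(hon x hx.1).2 hk.symm, fun v => by
      rw [real_inner_comm]; exact hd k j x hx.1 v⟩
  refine ⟨hRo, (hX j).mono hRV, fun x hx => mem_sphere_zero_iff_norm.2 ((hon x hx.1).1 j),
    fun x hx => hx.2, ?_⟩
  have hspan : ∀ x ∈ R, normalSpace (X j) x
      = Submodule.span ℝ (range fun k : {k // k ≠ j} => X k x) := by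
    intro x hx
    have hle : Submodule.span ℝ (range fun k : {k // k ≠ j} => X k x) ≤ normalSpace (X j) x := by
      rw [Submodule.span_le]
      rintro _ ⟨k, rfl⟩
      exact hmem k k.2 x hx
    refine (Submodule.eq_of_le_of_finrank_le hle ?_).symm
    have h1 := finrank_normalSpace (injective_coneDifferential (h11 x hx)
      (fun v => hd j j x hx.1 v) hx.2)
    have h2 := finrank_span_eq_card
      ((hon x hx.1).comp _ (Subtype.val_injective (p := fun k => k ≠ j))).linearIndependent
    have h3 : Fintype.card {k // k ≠ j} = Fintype.card κ - 1 := by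
      rw [← Fintype.card_subtype_eq j]
      exact Fintype.card_subtype_compl fun k => k = j
    have h4 : 0 < Fintype.card κ := Fintype.card_pos_iff.2 ⟨j⟩
    simp only [Function.comp_def] at h2
    omega
  refine normalCurvatureZeroOn_of_parallel_frame (κ := {k // k ≠ j}) (X := fun k => X k) hRo
    (fun k => (hX k).mono hRV) (fun x hx => (hon x hx.1).comp _ Subtype.val_injective)
    hspan (fun k x hx v => ?_)
  rw [normalDeriv, Submodule.starProjection_apply_eq_zero_iff, hspan x hx,
    Submodule.mem_orthogonal]
  intro u hu
  obtain ⟨c, rfl⟩ := (Submodule.mem_span_range_iff_exists_fun ℝ).1 hu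
  simp [sum_inner, inner_smul_left, hd _ k.1 x hx.1 v]

end Frame

section Direct

variable {n m : ℕ} {U V : Set (Eucl n)} {φ : Fin m → Eucl n → ℝ}
  {Ω : Eucl n → Matrix (Fin m) (Fin m) ℝ}

theorem IsRibaucourData.contDiffOn_gradMatrix (h : IsRibaucourData U V φ Ω) (a : Fin n)
    (i : Fin m) : ContDiffOn ℝ ∞ (fun x => gradMatrix φ x a i) V := by
  have h1 : ContDiffOn ℝ ∞ (∇ (φ i)) V :=
    (InnerProductSpace.toDual ℝ (Eucl n)).symm.contDiff.comp_contDiffOn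
      (((h.contDiffOn_φ i).mono h.V_subset_U).fderiv_of_isOpen h.isOpen_V (by simp))
  exact (contDiff_euclidean.1 contDiff_id a).comp_contDiffOn h1

theorem IsRibaucourData.contDiffOn_inv (h : IsRibaucourData U V φ Ω) (i j : Fin m) :
    ContDiffOn ℝ ∞ (fun x => (Ω x)⁻¹ i j) V :=
  contDiffOn_matrix_inv h.contDiffOn_Ω h.isUnit_Ω i j

theorem IsRibaucourData.contDiffOn_matW (h : IsRibaucourData U V φ Ω) (a : Fin n ⊕ Fin m)
    (j : Fin m) : ContDiffOn ℝ ∞ (fun x => matW φ Ω x a j) V := by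
  cases a with
  | inl a => exact contDiffOn_matrix_mul h.contDiffOn_gradMatrix h.contDiffOn_inv a j
  | inr i => exact contDiffOn_const.sub (h.contDiffOn_inv i j)

theorem mul_nonsing_inv_of_isUnit {κ : Type*} [Fintype κ] [DecidableEq κ] {A : Matrix κ κ ℝ}
    (h : IsUnit A) : A * A⁻¹ = 1 :=
  Matrix.mul_nonsing_inv _ ((Matrix.isUnit_iff_isUnit_det _).1 h)

theorem transpose_fromRows_mul_fromRows {ι κ μ : Type*} [Fintype ι] [Fintype κ]
    (A A' : Matrix ι μ ℝ) (B B' : Matrix κ μ ℝ) :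
    (Matrix.fromRows A B).transpose * Matrix.fromRows A' B'
      = A.transpose * A' + B.transpose * B' := by
  rw [Matrix.transpose_fromRows, Matrix.fromCols_mul_fromRows]

theorem IsRibaucourData.transpose_matW_mul_matW (h : IsRibaucourData U V φ Ω) {x : Eucl n}
    (hx : x ∈ V) : (matW φ Ω x).transpose * matW φ Ω x = 1 := by
  rw [matW, transpose_fromRows_mul_fromRows]
  exact gram_of_symm (mul_nonsing_inv_of_isUnit (h.isUnit_Ω x hx)) (h.symm_Ω x hx)

theorem matrixDeriv_fromRows {ι κ μ : Type*} (A : Eucl n → Matrix ι μ ℝ)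
    (B : Eucl n → Matrix κ μ ℝ) (x v : Eucl n) :
    matrixDeriv (fun y => Matrix.fromRows (A y) (B y)) x v
      = Matrix.fromRows (matrixDeriv A x v) (matrixDeriv B x v) := by
  ext a j
  cases a <;> rfl

theorem IsRibaucourData.transpose_matW_mul_matrixDeriv (h : IsRibaucourData U V φ Ω) {x : Eucl n}
    (hx : x ∈ V) (v : Eucl n) :
    (matW φ Ω x).transpose * matrixDeriv (matW φ Ω) x v = 0 := by
  have hu := h.isUnit_Ω x hx
  have hd : ∀ {f : Eucl n → ℝ}, ContDiffOn ℝ ∞ f V → DifferentiableAt ℝ f x := fun hf =>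
    (hf.contDiffAt (h.isOpen_V.mem_nhds hx)).differentiableAt (by simp)
  have h1 := matrixDeriv_fromRows (fun y => gradMatrix φ y * (Ω y)⁻¹) (fun y => 1 - (Ω y)⁻¹) x v
  rw [matrixDeriv_mul (fun i j => hd (h.contDiffOn_gradMatrix i j))
    (fun i j => hd (h.contDiffOn_inv i j)), matrixDeriv_const_sub] at h1
  have h2 : matrixDeriv (matW φ Ω) x v = _ := h1
  rw [h2, matW, transpose_fromRows_mul_fromRows]
  refine deriv_gram_of_symm (mul_nonsing_inv_of_isUnit hu) ?_ (h.symm_Ω x hx) (h.deriv_Ω x hx v)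
  exact matrixDeriv_mul_add_mul_matrixDeriv_of_mul_eq_one h.isOpen_V h.contDiffOn_inv
    h.contDiffOn_Ω (fun y hy => mul_eq_one_comm.1 (mul_nonsing_inv_of_isUnit (h.isUnit_Ω y hy)))
    hx v

/-- The differential of a column of a matrix-valued map, entry by entry. -/
theorem fderiv_toLp_apply {ι : Type*} [Fintype ι] {f : Eucl n → ι → ℝ} {x : Eucl n}
    (hf : ∀ a, DifferentiableAt ℝ (fun y => f y a) x) (v : Eucl n) (a : ι) :
    fderiv ℝ (fun y => WithLp.toLp 2 (f y) : Eucl n → EuclideanSpace ℝ ι) x v a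
      = fderiv ℝ (fun y => f y a) x v := by
  have h1 : DifferentiableAt ℝ (fun y => WithLp.toLp 2 (f y) : Eucl n → EuclideanSpace ℝ ι) x :=
    differentiableAt_euclidean.2 hf
  have h2 : fderiv ℝ (fun y => f y a) x = _ :=
    ((EuclideanSpace.proj (𝕜 := ℝ) a).hasFDerivAt.comp x h1.hasFDerivAt).fderiv
  exact congrArg (fun L : Eucl n →L[ℝ] ℝ => L v) h2.symm

theorem inner_toLp_eq_transpose_mul {ι κ : Type*} [Fintype ι] (A B : Matrix ι κ ℝ) (i j : κ) :
    inner ℝ (WithLp.toLp 2 (fun a => A a i) : EuclideanSpace ℝ ι)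
      (WithLp.toLp 2 (fun a => B a j)) = (A.transpose * B) i j := by
  simp [PiLp.inner_apply, Matrix.mul_apply, mul_comm]

theorem IsRibaucourData.isSphericalImmersionWithFlatNormalBundleOn_colW
    (h : IsRibaucourData U V φ Ω) (j : Fin m) :
    IsSphericalImmersionWithFlatNormalBundleOn (colW φ Ω j) (regularSet V φ Ω j) := by
  have hd : ∀ a k, ∀ x ∈ V, DifferentiableAt ℝ (fun y => matW φ Ω y a k) x := fun a k x hx =>
    ((h.contDiffOn_matW a k).contDiffAt (h.isOpen_V.mem_nhds hx)).differentiableAt (by simp)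
  refine isSphericalImmersionWithFlatNormalBundleOn_of_frame (X := colW φ Ω) h.isOpen_V
    (fun k => contDiffOn_euclidean.2 fun a => h.contDiffOn_matW a k) (fun x hx => ?_)
    (fun i k x hx v => ?_) (by simp) j
  · rw [orthonormal_iff_ite]
    intro i k
    rw [colW, colW, inner_toLp_eq_transpose_mul, h.transpose_matW_mul_matW hx, Matrix.one_apply]
  · have h1 : fderiv ℝ (colW φ Ω k) x v
        = WithLp.toLp 2 fun a => matrixDeriv (matW φ Ω) x v a k := by
      ext a
      exact fderiv_toLp_apply (fun a => hd a k x hx) v a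
    rw [h1, colW, inner_toLp_eq_transpose_mul, h.transpose_matW_mul_matrixDeriv hx,
      Matrix.zero_apply]

end Direct

/-! ### Parallel normal frames, coordinates and gradients -/

section ParallelFrame

variable {E F : Type*} [NormedAddCommGroup E] [NormedSpace ℝ E]
  [NormedAddCommGroup F] [InnerProductSpace ℝ F]

theorem fderiv_inner_eq {X Y : E → F} {x : E} (hX : DifferentiableAt ℝ X x)
    (hY : DifferentiableAt ℝ Y x) (v : E) :
    fderiv ℝ (fun y => inner ℝ (X y) (Y y)) x v
      = inner ℝ (X x) (fderiv ℝ Y x v) + inner ℝ (Y x) (fderiv ℝ X x v) := by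
  rw [fderiv_inner_apply ℝ hX hY, real_inner_comm (Y x)]

/-- An immersion into the sphere with flat normal bundle is, near a given point, a member of an
orthonormal frame whose differentials are orthogonal to all of them. -/
theorem IsSphericalImmersionWithFlatNormalBundleOn.exists_frame [FiniteDimensional ℝ E]
    [FiniteDimensional ℝ F] {κ : Type*} [Fintype κ] {g : E → F} {R : Set E}
    (h : IsSphericalImmersionWithFlatNormalBundleOn g R) {x₀ : E} (hx₀ : x₀ ∈ R)
    (hrank : Module.finrank ℝ F = Module.finrank ℝ E + Fintype.card κ) (j : κ) :
    ∃ X : κ → E → F, ∃ r > 0, Metric.ball x₀ r ⊆ R ∧ X j = g ∧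
      (∀ k, ContDiffOn ℝ ∞ (X k) (Metric.ball x₀ r)) ∧
      (∀ x ∈ Metric.ball x₀ r, Orthonormal ℝ fun k => X k x) ∧
      ∀ i k, ∀ x ∈ Metric.ball x₀ r, ∀ v, inner ℝ (X i x) (fderiv ℝ (X k) x v) = 0 := by
  classical
  obtain ⟨r, hr, hrR, hex⟩ := h.exists_parallel hx₀
  have hcard : Module.finrank ℝ (normalSpace g x₀) = Fintype.card {k // k ≠ j} := by
    have h1 := finrank_normalSpace (h.injective_coneDifferential hx₀)
    have h3 : Fintype.card {k // k ≠ j} = Fintype.card κ - 1 := by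
      rw [← Fintype.card_subtype_eq j]
      exact Fintype.card_subtype_compl fun k => k = j
    have h4 : 0 < Fintype.card κ := Fintype.card_pos_iff.2 ⟨j⟩
    omega
  let b : OrthonormalBasis {k // k ≠ j} ℝ (normalSpace g x₀) :=
    (stdOrthonormalBasis ℝ (normalSpace g x₀)).reindex
      (Fintype.equivOfCardEq (by rw [Fintype.card_fin, hcard]))
  have hexb := fun k => hex (b k) (b k).2
  choose ξ hξ₀ hξ hξN using hexb
  let X : κ → E → F := fun k => if hk : k ≠ j then ξ ⟨k, hk⟩ else g
  have hXj : X j = g := dif_neg (by simp)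
  have hXk : ∀ k : {k // k ≠ j}, X k = ξ k := fun k => dif_pos k.2
  have hXs : ∀ k, ContDiffOn ℝ ∞ (X k) (Metric.ball x₀ r) := by
    intro k
    by_cases hk : k = j
    · rw [hk, hXj]; exact h.contDiffOn.mono hrR
    · rw [hXk ⟨k, hk⟩]; exact hξ _
  have hXd : ∀ k, ∀ x ∈ Metric.ball x₀ r, DifferentiableAt ℝ (X k) x := fun k x hx =>
    ((hXs k).contDiffAt (Metric.isOpen_ball.mem_nhds hx)).differentiableAt (by simp)
  have hd : ∀ i k, ∀ x ∈ Metric.ball x₀ r, ∀ v, inner ℝ (X i x) (fderiv ℝ (X k) x v) = 0 := by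
    intro i k x hx v
    by_cases hi : i = j <;> by_cases hk : k = j
    · rw [hi, hk, hXj]
      exact inner_fderiv_eq_zero_of_norm_eq_one h.isOpen h.contDiffOn (fun _ => h.inner_self)
        (hrR hx) v
    · have h1 : (fun y => inner ℝ (X i y) (X k y)) =ᶠ[𝓝 x] fun _ => (0 : ℝ) := by
        filter_upwards [Metric.isOpen_ball.mem_nhds hx] with y hy
        rw [hi, hXj, hXk ⟨k, hk⟩]
        exact (mem_normalSpace_iff.1 (hξN ⟨k, hk⟩ y hy).1).1
      have h2 := fderiv_inner_eq (hXd i x hx) (hXd k x hx) v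
      rw [h1.fderiv_eq] at h2
      have h3 : inner ℝ (X k x) (fderiv ℝ (X i) x v) = 0 := by
        rw [hi, hXj, hXk ⟨k, hk⟩, real_inner_comm]
        exact (mem_normalSpace_iff.1 (hξN ⟨k, hk⟩ x hx).1).2 v
      rw [h3, add_zero] at h2
      rw [← h2]
      simp
    · rw [hk, hXj, hXk ⟨i, hi⟩, real_inner_comm]
      exact (mem_normalSpace_iff.1 (hξN ⟨i, hi⟩ x hx).1).2 v
    · rw [hXk ⟨k, hk⟩, hXk ⟨i, hi⟩]
      exact (Submodule.mem_orthogonal _ _).1 ((hξN ⟨k, hk⟩ x hx).2 v) _ (hξN ⟨i, hi⟩ x hx).1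
  have hconst : ∀ i k, ∀ x ∈ Metric.ball x₀ r,
      inner ℝ (X i x) (X k x) = (inner ℝ (X i x₀) (X k x₀) : ℝ) := by
    intro i k x hx
    refine Metric.isOpen_ball.is_const_of_fderiv_eq_zero (𝕜 := ℝ)
      (f := fun y => (inner ℝ (X i y) (X k y) : ℝ)) (convex_ball x₀ r).isPreconnected
      (((hXs i).inner ℝ (hXs k)).differentiableOn (by simp)) (fun y hy => ?_) hx
      (Metric.mem_ball_self hr)
    ext v
    rw [fderiv_inner_eq (hXd i y hy) (hXd k y hy), hd i k y hy, hd k i y hy]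
    simp
  refine ⟨X, r, hr, hrR, hXj, hXs, fun x hx => orthonormal_iff_ite.2 fun i k => ?_, hd⟩
  rw [hconst i k x hx]
  by_cases hi : i = j <;> by_cases hk : k = j
  · rw [hi, hk, hXj, if_pos rfl, h.inner_self hx₀]
  · rw [hi, hXj, hXk ⟨k, hk⟩, hξ₀, if_neg (Ne.symm hk)]
    exact (mem_normalSpace_iff.1 (b ⟨k, hk⟩).2).1
  · rw [hk, hXj, hXk ⟨i, hi⟩, hξ₀, if_neg hi, real_inner_comm]
    exact (mem_normalSpace_iff.1 (b ⟨i, hi⟩).2).1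
  · rw [hXk ⟨k, hk⟩, hXk ⟨i, hi⟩, hξ₀, hξ₀, ← Submodule.coe_inner,
      orthonormal_iff_ite.1 b.orthonormal]
    simp

end ParallelFrame

section Coordinates

variable {E : Type*} [NormedAddCommGroup E] [NormedSpace ℝ E] [FiniteDimensional ℝ E]

/-- A smooth map with injective differential at `x₀` is a coordinate system near `x₀`, whose image
may be taken to be a ball. -/
theorem exists_coordinates {f : E → E} {R : Set E} (hR : IsOpen R) (hf : ContDiffOn ℝ ∞ f R)
    {x₀ : E} (hx₀ : x₀ ∈ R) (hinj : Function.Injective (fderiv ℝ f x₀)) :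
    ∃ ψ : OpenPartialHomeomorph E E, x₀ ∈ ψ.source ∧ ψ.source ⊆ R ∧ (∀ x ∈ ψ.source, ψ x = f x) ∧
      ContDiffOn ℝ ∞ ψ ψ.source ∧ ContDiffOn ℝ ∞ ψ.symm ψ.target ∧
      ∃ r > 0, ψ.target = Metric.ball (f x₀) r := by
  have hequiv : ∀ x, Function.Injective (fderiv ℝ f x) →
      ∃ L : E ≃L[ℝ] E, (L : E →L[ℝ] E) = fderiv ℝ f x := fun x hx =>
    ⟨(LinearEquiv.ofInjectiveEndo (fderiv ℝ f x : E →ₗ[ℝ] E) hx).toContinuousLinearEquiv, by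
      ext; rfl⟩
  have hfx : ∀ x ∈ R, ContDiffAt ℝ ∞ f x := fun x hx => hf.contDiffAt (hR.mem_nhds hx)
  have hfd : ∀ x ∈ R, HasFDerivAt f (fderiv ℝ f x) x := fun x hx =>
    ((hfx x hx).differentiableAt (by simp)).hasFDerivAt
  obtain ⟨L, hL⟩ := hequiv x₀ hinj
  have hfL : HasFDerivAt f (L : E →L[ℝ] E) x₀ := hL ▸ hfd x₀ hx₀
  let e := (hfx x₀ hx₀).toOpenPartialHomeomorph f hfL (by simp)
  set O := R ∩ fderiv ℝ f ⁻¹' {T | Function.Injective T} with hO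
  have hOo : IsOpen O :=
    (hf.continuousOn_fderiv_of_isOpen hR (by simp)).isOpen_inter_preimage hR
      ContinuousLinearMap.isOpen_injective
  let e₁ := e.restrOpen O hOo
  have hx₁ : x₀ ∈ e₁.source :=
    ⟨(hfx x₀ hx₀).mem_toOpenPartialHomeomorph_source hfL (by simp), hx₀, hinj⟩
  obtain ⟨r, hr, hball⟩ := Metric.isOpen_iff.1 e₁.open_target (f x₀) (e₁.map_source hx₁)
  let ψ := (e₁.symm.restrOpen (Metric.ball (f x₀) r) Metric.isOpen_ball).symm
  have htarget : ψ.target = Metric.ball (f x₀) r := inter_eq_right.2 hball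
  have hsource : ψ.source ⊆ O := fun x hx => by
    have h3 : ψ.symm (ψ x) ∈ e₁.source := e₁.map_target (inter_subset_left (ψ.map_source hx))
    rw [ψ.left_inv hx] at h3
    exact h3.2
  have hx₂ : x₀ ∈ ψ.source := by
    have h1 : f x₀ ∈ ψ.target := by rw [htarget]; exact Metric.mem_ball_self hr
    have h2 := ψ.map_target h1
    have h3 : ψ.symm (f x₀) = x₀ := e₁.left_inv hx₁
    rwa [h3] at h2
  refine ⟨ψ, hx₂, fun x hx => (hsource hx).1, fun x _ => rfl,
    hf.mono fun x hx => (hsource hx).1, fun y hy => ?_, r, hr, htarget⟩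
  have hy' := hsource (ψ.map_target hy)
  obtain ⟨K, hK⟩ := hequiv _ hy'.2
  refine (ψ.contDiffAt_symm (f₀' := K) hy ?_ (hfx _ hy'.1)).contDiffWithinAt
  rw [hK]
  exact hfd _ hy'.1

end Coordinates

section Gradient

variable {H : Type*} [NormedAddCommGroup H] [InnerProductSpace ℝ H]

/-- A vector field on a convex open set whose differential is self-adjoint is a gradient. -/
theorem exists_gradient_eq [CompleteSpace H] {Y : H → H} {V : Set H} (hV : IsOpen V)
    (hconv : Convex ℝ V) (hY : ContDiffOn ℝ ∞ Y V)
    (hsymm : ∀ y ∈ V, ∀ u v, inner ℝ (fderiv ℝ Y y u) v = (inner ℝ (fderiv ℝ Y y v) u : ℝ)) :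
    ∃ φ : H → ℝ, ContDiffOn ℝ ∞ φ V ∧ ∀ y ∈ V, ∇ φ y = Y y := by
  let α : H → H →L[ℝ] ℝ := fun y => InnerProductSpace.toDual ℝ H (Y y)
  have hα : ContDiffOn ℝ ∞ α V := (InnerProductSpace.toDual ℝ H).contDiff.comp_contDiffOn hY
  have hαd : ∀ y ∈ V, DifferentiableAt ℝ α y := fun y hy =>
    (hα.contDiffAt (hV.mem_nhds hy)).differentiableAt (by simp)
  have hYd : ∀ y ∈ V, DifferentiableAt ℝ Y y := fun y hy =>
    (hY.contDiffAt (hV.mem_nhds hy)).differentiableAt (by simp)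
  have hdα : ∀ y ∈ V, ∀ u v, fderiv ℝ α y u v = inner ℝ (fderiv ℝ Y y u) v := by
    intro y hy u v
    have h1 : fderiv ℝ (fun z => α z v) y u = fderiv ℝ α y u v := by
      rw [fderiv_clm_apply (hαd y hy) (differentiableAt_const v)]
      simp
    have h2 : (fun z => α z v) = fun z => inner ℝ (Y z) v := rfl
    rw [← h1, h2, fderiv_inner_apply ℝ (hYd y hy) (differentiableAt_const v)]
    simp
  obtain ⟨φ, hφ⟩ := hconv.exists_forall_hasFDerivAt_of_fderiv_symmetric hV
    (fun y hy => (hαd y hy).differentiableWithinAt)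
    (fun y hy u v => by rw [hdα y hy, hdα y hy, hsymm y hy])
  refine ⟨φ, ?_, fun y hy => ?_⟩
  · exact (contDiffOn_infty_iff_fderiv_of_isOpen hV).2
      ⟨fun y hy => (hφ y hy).differentiableAt.differentiableWithinAt,
        hα.congr fun y hy => (hφ y hy).fderiv⟩
  · exact HasGradientAt.gradient (hφ y hy)

/-- The exterior derivative of `df = ⟪A, dB⟫`. -/
theorem inner_fderiv_fderiv_comm {E : Type*} [NormedAddCommGroup E] [NormedSpace ℝ E] {f : E → ℝ}
    {A B : E → H} {V : Set E} (hV : IsOpen V) (hf : ContDiffOn ℝ ∞ f V) (hA : ContDiffOn ℝ ∞ A V)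
    (hB : ContDiffOn ℝ ∞ B V) (hd : ∀ y ∈ V, ∀ v, fderiv ℝ f y v = inner ℝ (A y) (fderiv ℝ B y v))
    {y : E} (hy : y ∈ V) (u v : E) :
    inner ℝ (fderiv ℝ A y u) (fderiv ℝ B y v)
      = (inner ℝ (fderiv ℝ A y v) (fderiv ℝ B y u) : ℝ) := by
  have hyV := hV.mem_nhds hy
  have hAd : DifferentiableAt ℝ A y := (hA.contDiffAt hyV).differentiableAt (by simp)
  have hBdd := differentiableAt_fderiv (hB.contDiffAt hyV)
  have h1 : ∀ s t, fderiv ℝ (fderiv ℝ f) y s t = inner ℝ (A y) (fderiv ℝ (fderiv ℝ B) y s t)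
      + inner ℝ (fderiv ℝ A y s) (fderiv ℝ B y t) := by
    intro s t
    have h2 : (fun z => fderiv ℝ f z t) =ᶠ[𝓝 y] fun z => inner ℝ (A z) (fderiv ℝ B z t) := by
      filter_upwards [hyV] with z hz using hd z hz t
    rw [← fderiv_fderiv_apply (differentiableAt_fderiv (hf.contDiffAt hyV)), h2.fderiv_eq,
      fderiv_inner_apply ℝ hAd (hBdd.clm_apply (differentiableAt_const t)),
      fderiv_fderiv_apply hBdd]
  have h3 := fderiv_fderiv_comm (hf.contDiffAt hyV) u v
  rw [h1, h1, fderiv_fderiv_comm (hB.contDiffAt hyV) u v] at h3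
  exact add_left_cancel h3

end Gradient

/-! ### From a parallel frame to the data `(φ, Ω)` -/

section Converse

variable {n m : ℕ}

/-- If the differential of `Ω` is `Gᵗ dG` and a column of `G` is the position vector, then the
columns of `G` are gradients of functions with commuting Hessians. -/
theorem exists_isRibaucourData_of_column_eq_id {V : Set (Eucl n)} (hV : IsOpen V)
    (hconv : Convex ℝ V) (hne : V.Nonempty) {G : Eucl n → Matrix (Fin n) (Fin m) ℝ}
    {Ω : Eucl n → Matrix (Fin m) (Fin m) ℝ}
    (hG : ∀ a i, ContDiffOn ℝ ∞ (fun y => G y a i) V)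
    (hΩ : ∀ i j, ContDiffOn ℝ ∞ (fun y => Ω y i j) V) (hu : ∀ y ∈ V, IsUnit (Ω y))
    (hd : ∀ y ∈ V, ∀ v, matrixDeriv Ω y v = (G y).transpose * matrixDeriv G y v)
    (hsymm : ∀ y ∈ V, Ω y + (Ω y).transpose = (G y).transpose * G y + 1)
    {j : Fin m} (hj : ∀ y ∈ V, ∀ a, G y a j = y a) :
    ∃ φ : Fin m → Eucl n → ℝ, IsRibaucourData V V φ Ω ∧ ∀ y ∈ V, gradMatrix φ y = G y := by
  let Y : Fin m → Eucl n → Eucl n := fun k y => WithLp.toLp 2 fun a => G y a k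
  have hY : ∀ k, ContDiffOn ℝ ∞ (Y k) V := fun k => contDiffOn_euclidean.2 fun a => hG a k
  have hGd : ∀ a k, ∀ y ∈ V, DifferentiableAt ℝ (fun y => G y a k) y := fun a k y hy =>
    ((hG a k).contDiffAt (hV.mem_nhds hy)).differentiableAt (by simp)
  have hdΩ : ∀ i k, ∀ y ∈ V, ∀ v,
      fderiv ℝ (fun y => Ω y i k) y v = inner ℝ (Y i y) (fderiv ℝ (Y k) y v) := by
    intro i k y hy v
    have h1 : fderiv ℝ (Y k) y v = WithLp.toLp 2 fun a => matrixDeriv G y v a k := by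
      ext a
      exact fderiv_toLp_apply (fun a => hGd a k y hy) v a
    rw [h1, inner_toLp_eq_transpose_mul, ← hd y hy v]
    rfl
  have hclosed : ∀ i k, ∀ y ∈ V, ∀ u v, inner ℝ (fderiv ℝ (Y i) y u) (fderiv ℝ (Y k) y v)
      = (inner ℝ (fderiv ℝ (Y i) y v) (fderiv ℝ (Y k) y u) : ℝ) := fun i k y hy u v =>
    inner_fderiv_fderiv_comm hV (hΩ i k) (hY i) (hY k) (hdΩ i k) hy u v
  have hYj : ∀ y ∈ V, fderiv ℝ (Y j) y = ContinuousLinearMap.id ℝ (Eucl n) := by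
    intro y hy
    have h1 : Y j =ᶠ[𝓝 y] id := by
      filter_upwards [hV.mem_nhds hy] with z hz
      ext a
      exact hj z hz a
    rw [h1.fderiv_eq, fderiv_id]
  have hself : ∀ k, ∀ y ∈ V, ∀ u v, inner ℝ (fderiv ℝ (Y k) y u) v
      = (inner ℝ (fderiv ℝ (Y k) y v) u : ℝ) := by
    intro k y hy u v
    have h1 := hclosed j k y hy v u
    rw [hYj y hy] at h1
    rw [real_inner_comm, real_inner_comm u]
    exact h1
  have hφ := fun k => exists_gradient_eq hV hconv (hY k) (hself k)
  choose φ hφs hφY using hφ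
  have hGφ : ∀ y ∈ V, gradMatrix φ y = G y := by
    intro y hy
    ext a k
    simp only [gradMatrix, Matrix.of_apply, hφY k y hy, Y]
  have hhess : ∀ k, ∀ y ∈ V, hess (φ k) y = fderiv ℝ (Y k) y := by
    intro k y hy
    refine Filter.EventuallyEq.fderiv_eq ?_
    filter_upwards [hV.mem_nhds hy] with z hz using hφY k z hz
  refine ⟨φ, ?_, hGφ⟩
  refine
    { isOpen_U := hV
      simplyConnected_U := ?_
      contDiffOn_φ := hφs
      commute_hess := fun i k y hy => ?_
      isOpen_V := hV
      V_subset_U := subset_rfl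
      contDiffOn_Ω := hΩ
      isUnit_Ω := hu
      deriv_Ω := fun y hy v => ?_
      symm_Ω := fun y hy => ?_ }
  · have := hconv.contractibleSpace hne
    exact SimplyConnectedSpace.ofContractible V
  · rw [hhess i y hy, hhess k y hy]
    ext1 v
    refine ext_inner_right ℝ fun u => ?_
    simp only [mul_apply_eq_comp]
    exact (hself i y hy _ u).trans ((hclosed i k y hy u v).trans
      ((real_inner_comm _ _).trans (hself k y hy _ u).symm))
  · have h1 : gradMatrix φ =ᶠ[𝓝 y] G := by
      filter_upwards [hV.mem_nhds hy] with z hz using hGφ z hz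
    rw [hGφ y hy, matrixDeriv_congr h1, hd y hy]
  · rw [hGφ y hy, hsymm y hy]

/-- An orthonormal family of `m` vectors can be moved to the negative of the last `m` vectors of the
standard basis. -/
theorem exists_linearIsometryEquiv_eq_neg_single {v : Fin m → Amb n m} (hv : Orthonormal ℝ v) :
    ∃ T : Amb n m ≃ₗᵢ[ℝ] Amb n m, ∀ k, T (v k) = -EuclideanSpace.single (Sum.inr k) 1 := by
  have h1 : Orthonormal ℝ ((range (Sum.inr : Fin m → Fin n ⊕ Fin m)).domRestrict
      (Sum.elim (fun _ => 0) v : Fin n ⊕ Fin m → Amb n m)) := by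
    let e : range (Sum.inr : Fin m → Fin n ⊕ Fin m) ≃ Fin m :=
      (Equiv.ofInjective _ Sum.inr_injective).symm
    have h2 := hv.comp e e.injective
    convert h2 using 1
    ext1 ⟨_, k, rfl⟩
    have h3 : e ⟨Sum.inr k, k, rfl⟩ = k := Equiv.ofInjective_symm_apply Sum.inr_injective k
    simp only [Function.comp_apply, h3]
    rfl
  obtain ⟨b, hb⟩ := h1.exists_orthonormalBasis_extension_of_card_eq (by simp)
  refine ⟨b.repr.trans (LinearIsometryEquiv.neg ℝ), fun k => ?_⟩
  have h2 : b (Sum.inr k) = v k := hb _ ⟨k, rfl⟩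
  rw [← h2, LinearIsometryEquiv.trans_apply, b.repr_self]
  rfl

/-- A member of an orthonormal frame whose differentials are orthogonal to all of them is, up to a
linear isometry and a change of coordinates, a column of `W`. -/
theorem exists_isRibaucourData_of_frame {X : Fin m → Eucl n → Amb n m} {R : Set (Eucl n)}
    (hR : IsOpen R) (hX : ∀ k, ContDiffOn ℝ ∞ (X k) R)
    (hon : ∀ x ∈ R, Orthonormal ℝ fun k => X k x)
    (hd : ∀ i k, ∀ x ∈ R, ∀ v, inner ℝ (X i x) (fderiv ℝ (X k) x v) = 0)
    {x₀ : Eucl n} (hx₀ : x₀ ∈ R) (j : Fin m) (hinj : Function.Injective (fderiv ℝ (X j) x₀)) :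
    ∃ (V : Set (Eucl n)) (φ : Fin m → Eucl n → ℝ) (Ω : Eucl n → Matrix (Fin m) (Fin m) ℝ)
      (T : Amb n m ≃ₗᵢ[ℝ] Amb n m) (ψ : OpenPartialHomeomorph (Eucl n) (Eucl n)),
      IsRibaucourData V V φ Ω ∧ x₀ ∈ ψ.source ∧ ψ.source ⊆ R ∧ ContDiffOn ℝ ∞ ψ ψ.source ∧
      ContDiffOn ℝ ∞ ψ.symm ψ.target ∧ ψ.target = V ∧
      ∀ y ∈ V, T (X j (ψ.symm y)) = colW φ Ω j y := by
  obtain ⟨T, hT⟩ := exists_linearIsometryEquiv_eq_neg_single (hon x₀ hx₀)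
  -- the blocks `A` and `1 - D` of the matrix with the columns `T (X k)`
  let A : Eucl n → Matrix (Fin n) (Fin m) ℝ := fun x => Matrix.of fun a k => T (X k x) (Sum.inl a)
  let D : Eucl n → Matrix (Fin m) (Fin m) ℝ := fun x =>
    1 - Matrix.of fun i k => T (X k x) (Sum.inr i)
  have hTX : ∀ k, ContDiffOn ℝ ∞ (fun x => T (X k x)) R := fun k =>
    T.contDiff.comp_contDiffOn (hX k)
  have hTXa : ∀ a k, ContDiffOn ℝ ∞ (fun x => T (X k x) a) R := fun a k =>
    contDiffOn_euclidean.1 (hTX k) a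
  have hA : ∀ a k, ContDiffOn ℝ ∞ (fun x => A x a k) R := fun a k => hTXa (Sum.inl a) k
  have hD : ∀ i k, ContDiffOn ℝ ∞ (fun x => D x i k) R := fun i k =>
    contDiffOn_const.sub (hTXa (Sum.inr i) k)
  have hcol : ∀ x k, T (X k x) = WithLp.toLp 2 fun a => Matrix.fromRows (A x) (1 - D x) a k := by
    intro x k
    ext a
    cases a <;> simp [A, D]
  have hTXd : ∀ k, ∀ x ∈ R, ∀ v, T (fderiv ℝ (X k) x v)
      = WithLp.toLp 2 fun a => Matrix.fromRows (matrixDeriv A x v) (-matrixDeriv D x v) a k := by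
    intro k x hx v
    have h1 : DifferentiableAt ℝ (X k) x :=
      ((hX k).contDiffAt (hR.mem_nhds hx)).differentiableAt (by simp)
    have h2 : HasFDerivAt (fun x => T (X k x))
        ((T.toContinuousLinearEquiv : Amb n m →L[ℝ] Amb n m) ∘L fderiv ℝ (X k) x) x :=
      (T.toContinuousLinearEquiv : Amb n m →L[ℝ] Amb n m).hasFDerivAt.comp x h1.hasFDerivAt
    have h3 : T (fderiv ℝ (X k) x v) = fderiv ℝ (fun x => T (X k x)) x v := by
      rw [h2.fderiv]; rfl
    have h4 : (fun x => T (X k x))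
        = fun x => WithLp.toLp 2 fun a => Matrix.fromRows (A x) (1 - D x) a k :=
      funext fun x => hcol x k
    rw [h3, h4, ← matrixDeriv_const_sub 1, ← matrixDeriv_fromRows]
    ext a
    refine fderiv_toLp_apply (fun a => ?_) v a
    have h5 := ((hTXa a k).contDiffAt (hR.mem_nhds hx)).differentiableAt (by simp)
    simp only [hcol] at h5
    exact h5
  have hgram : ∀ x ∈ R, (A x).transpose * A x + (1 - D x).transpose * (1 - D x) = 1 := by
    intro x hx
    rw [← transpose_fromRows_mul_fromRows]
    ext i k
    rw [← inner_toLp_eq_transpose_mul, ← hcol, ← hcol, T.inner_map_map,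
      orthonormal_iff_ite.1 (hon x hx), Matrix.one_apply]
  have hgram' : ∀ x ∈ R, ∀ v, (A x).transpose * matrixDeriv A x v
      + (1 - D x).transpose * -matrixDeriv D x v = 0 := by
    intro x hx v
    rw [← transpose_fromRows_mul_fromRows]
    ext i k
    rw [← inner_toLp_eq_transpose_mul, ← hcol, ← hTXd k x hx, T.inner_map_map, hd i k x hx,
      Matrix.zero_apply]
  have hA₀ : A x₀ = 0 := by
    ext a k
    simp [A, hT]
  have hD₀ : D x₀ = (2 : ℝ) • 1 := by
    ext i k
    simp only [D, hT, Matrix.sub_apply, Matrix.of_apply, Matrix.smul_apply, Matrix.one_apply]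
    by_cases hik : i = k
    · simp [hik]; norm_num
    · simp [hik]
  have hD₀' : ∀ v, matrixDeriv D x₀ v = 0 := by
    intro v
    have h1 := hgram' x₀ hx₀ v
    have h2 : (1 : Matrix (Fin m) (Fin m) ℝ) - (2 : ℝ) • 1 = -1 := by
      rw [two_smul]; abel
    rw [hA₀, hD₀, h2] at h1
    simpa using h1
  -- shrink the domain to where `D` is invertible
  set R₁ := R ∩ (fun x => (D x).det) ⁻¹' {0}ᶜ with hR₁
  have hR₁R : R₁ ⊆ R := inter_subset_left
  have hR₁o : IsOpen R₁ :=
    (contDiffOn_matrix_det hD).continuousOn.isOpen_inter_preimage hR isOpen_compl_singleton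
  have hx₁ : x₀ ∈ R₁ := by
    refine ⟨hx₀, ?_⟩
    simp [hD₀]
  have hDu : ∀ x ∈ R₁, IsUnit (D x) := fun x hx =>
    (Matrix.isUnit_iff_isUnit_det _).2 (isUnit_iff_ne_zero.2 hx.2)
  let Ω : Eucl n → Matrix (Fin m) (Fin m) ℝ := fun x => (D x)⁻¹
  let G : Eucl n → Matrix (Fin n) (Fin m) ℝ := fun x => A x * Ω x
  have hΩ : ∀ i k, ContDiffOn ℝ ∞ (fun x => Ω x i k) R₁ :=
    contDiffOn_matrix_inv (fun i k => (hD i k).mono hR₁R) hDu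
  have hG : ∀ a k, ContDiffOn ℝ ∞ (fun x => G x a k) R₁ :=
    contDiffOn_matrix_mul (fun a k => (hA a k).mono hR₁R) hΩ
  have hdiff : ∀ {f : Eucl n → ℝ}, ContDiffOn ℝ ∞ f R₁ → ∀ x ∈ R₁, DifferentiableAt ℝ f x :=
    fun hf x hx => (hf.contDiffAt (hR₁o.mem_nhds hx)).differentiableAt (by simp)
  have hΩD : ∀ x ∈ R₁, Ω x * D x = 1 := fun x hx =>
    mul_eq_one_comm.1 (mul_nonsing_inv_of_isUnit (hDu x hx))
  have hΩu : ∀ x ∈ R₁, IsUnit (Ω x) := fun x hx => IsUnit.of_mul_eq_one _ (hΩD x hx)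
  have hsymm : ∀ x ∈ R₁, Ω x + (Ω x).transpose = (G x).transpose * G x + 1 := fun x hx =>
    symm_of_gram (hΩD x hx) (hgram x (hR₁R hx))
  have hΩ' : ∀ x ∈ R₁, ∀ v, matrixDeriv Ω x v * D x + Ω x * matrixDeriv D x v = 0 :=
    fun x hx v => matrixDeriv_mul_add_mul_matrixDeriv_of_mul_eq_one hR₁o hΩ
      (fun i k => (hD i k).mono hR₁R) hΩD hx v
  have hG' : ∀ x ∈ R₁, ∀ v,
      matrixDeriv G x v = matrixDeriv A x v * Ω x + A x * matrixDeriv Ω x v := fun x hx v =>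
    matrixDeriv_mul (fun a k => hdiff ((hA a k).mono hR₁R) x hx)
      (fun i k => hdiff (hΩ i k) x hx) v
  have hdΩ : ∀ x ∈ R₁, ∀ v, matrixDeriv Ω x v = (G x).transpose * matrixDeriv G x v := by
    intro x hx v
    rw [hG' x hx v]
    exact deriv_of_gram (hΩD x hx) (hΩ' x hx v) (hgram x (hR₁R hx)) (hgram' x (hR₁R hx) v)
  -- the `j`-th column of `G` as a coordinate system
  let f : Eucl n → Eucl n := fun x => WithLp.toLp 2 fun a => G x a j
  have hf : ContDiffOn ℝ ∞ f R₁ := contDiffOn_euclidean.2 fun a => hG a j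
  have hΩ₀ : Ω x₀ = (2⁻¹ : ℝ) • 1 := by
    refine Matrix.inv_eq_left_inv ?_
    rw [hD₀, smul_mul_smul_comm, mul_one]
    norm_num
  have hfinj : Function.Injective (fderiv ℝ f x₀) := by
    refine (injective_iff_map_eq_zero _).2 fun v hv => ?_
    have h1 : ∀ a, matrixDeriv A x₀ v a j = 0 := by
      intro a
      have h2 : fderiv ℝ f x₀ v a = matrixDeriv G x₀ v a j :=
        fderiv_toLp_apply (fun a => hdiff (hG a j) x₀ hx₁) v a
      rw [hv, hG' x₀ hx₁, hA₀, hΩ₀] at h2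
      simpa using h2
    have h3 : T (fderiv ℝ (X j) x₀ v) = 0 := by
      rw [hTXd j x₀ hx₀, hD₀']
      ext a
      cases a <;> simp [h1]
    exact hinj (by rw [map_zero]; exact T.map_eq_zero_iff.1 h3)
  obtain ⟨ψ, hψ₀, hψR, hψf, hψ, hψs, r, hr, hψt⟩ := exists_coordinates hR₁o hf hx₁ hfinj
  set V := ψ.target
  have hVR : ∀ y ∈ V, ψ.symm y ∈ R₁ := fun y hy => hψR (ψ.map_target hy)
  have hψd : ∀ y ∈ V, DifferentiableAt ℝ ψ.symm y := fun y hy =>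
    (hψs.contDiffAt (ψ.open_target.mem_nhds hy)).differentiableAt (by simp)
  obtain ⟨φ, hφ, hφG⟩ := exists_isRibaucourData_of_column_eq_id (V := V) ψ.open_target
    (by rw [hψt]; exact convex_ball _ _) ⟨f x₀, by rw [hψt]; exact Metric.mem_ball_self hr⟩
    (G := fun y => G (ψ.symm y)) (Ω := fun y => Ω (ψ.symm y))
    (fun a k => (hG a k).comp hψs hVR) (fun i k => (hΩ i k).comp hψs hVR)
    (fun y hy => hΩu _ (hVR y hy))
    (fun y hy v => by
      rw [matrixDeriv_comp (fun i k => hdiff (hΩ i k) _ (hVR y hy)) (hψd y hy),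
        matrixDeriv_comp (fun i k => hdiff (hG i k) _ (hVR y hy)) (hψd y hy)]
      exact hdΩ _ (hVR y hy) _)
    (fun y hy => hsymm _ (hVR y hy)) (j := j)
    (fun y hy a => by
      have h1 : f (ψ.symm y) = y := by
        rw [← hψf _ (ψ.map_target hy), ψ.right_inv hy]
      exact congrArg (fun z : Eucl n => z a) h1)
  refine ⟨V, φ, _, T, ψ, hφ, hψ₀, hψR.trans hR₁R, hψ, hψs, rfl, fun y hy => ?_⟩
  have h1 : (Ω (ψ.symm y))⁻¹ = D (ψ.symm y) :=
    Matrix.inv_eq_right_inv (hΩD _ (hVR y hy))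
  have h2 : G (ψ.symm y) * D (ψ.symm y) = A (ψ.symm y) := by
    show A (ψ.symm y) * Ω (ψ.symm y) * D (ψ.symm y) = _
    rw [Matrix.mul_assoc, hΩD _ (hVR y hy), Matrix.mul_one]
  rw [hcol, colW, matW, hφG y hy, h1, h2]

end Converse

/-! ### Manifolds -/

section Charts

variable {n : ℕ} {M : Type*} [TopologicalSpace M] [ChartedSpace (Eucl n) M]

/-- Composing a chart with a smooth change of coordinates gives a chart. -/
theorem trans_mem_maximalAtlas [IsManifold (𝓡 n) ∞ M] {e : OpenPartialHomeomorph M (Eucl n)}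
    (he : e ∈ IsManifold.maximalAtlas (𝓡 n) ∞ M) {ψ : OpenPartialHomeomorph (Eucl n) (Eucl n)}
    (hψ : ContDiffOn ℝ ∞ ψ ψ.source) (hψs : ContDiffOn ℝ ∞ ψ.symm ψ.target) :
    e.trans ψ ∈ IsManifold.maximalAtlas (𝓡 n) ∞ M := by
  have hψG : ψ ∈ contDiffGroupoid ∞ (𝓡 n) := by
    rw [contDiffGroupoid, mem_groupoid_of_pregroupoid]
    simp only [contDiffPregroupoid, modelWithCornersSelf_coe,
      modelWithCornersSelf_coe_symm, Function.comp_id, Function.id_comp, preimage_id_eq, id_eq,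
      range_id, inter_univ]
    exact ⟨hψ, hψs⟩
  intro e' he'
  obtain ⟨h1, h2⟩ := mem_maximalAtlas_iff.1 he e' he'
  constructor
  · rw [OpenPartialHomeomorph.trans_symm_eq_symm_trans_symm, OpenPartialHomeomorph.trans_assoc]
    exact (contDiffGroupoid ∞ (𝓡 n)).trans ((contDiffGroupoid ∞ (𝓡 n)).symm hψG) h1
  · rw [← OpenPartialHomeomorph.trans_assoc]
    exact (contDiffGroupoid ∞ (𝓡 n)).trans h2 hψG

variable {F : Type*} [NormedAddCommGroup F] [InnerProductSpace ℝ F] [FiniteDimensional ℝ F]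

/-- In a chart, an immersion of a manifold into the sphere with flat normal bundle is an immersion
of an open set with these properties. -/
theorem IsSphericalImmersionWithFlatNormalBundle.comp_symm [IsManifold (𝓡 n) ∞ M] {f : M → F}
    (h : IsSphericalImmersionWithFlatNormalBundle n f) {e : OpenPartialHomeomorph M (Eucl n)}
    (he : e ∈ IsManifold.maximalAtlas (𝓡 n) ∞ M) :
    IsSphericalImmersionWithFlatNormalBundleOn (f ∘ e.symm) e.target := by
  have hes : ContMDiffOn (𝓡 n) (𝓡 n) ∞ e.symm e.target := contMDiffOn_symm_of_mem_maximalAtlas he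
  refine ⟨e.open_target, (h.contMDiff.comp_contMDiffOn hes).contDiffOn,
    fun x _ => h.mem_sphere _, fun x hx => ?_, h.flat e he⟩
  have hesx : ContMDiffAt (𝓡 n) (𝓡 n) ∞ e.symm x := hes.contMDiffAt (e.open_target.mem_nhds hx)
  have h1 : MDifferentiableAt (𝓡 n) (𝓡 n) e.symm x := hesx.mdifferentiableAt (by simp)
  have h2 : MDifferentiableAt (𝓡 n) 𝓘(ℝ, F) f (e.symm x) :=
    (h.contMDiff _).mdifferentiableAt (by simp)
  have h3 : MDifferentiableAt (𝓡 n) (𝓡 n) e (e.symm x) :=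
    ((contMDiffOn_of_mem_maximalAtlas he).contMDiffAt
      (e.open_source.mem_nhds (e.map_target hx))).mdifferentiableAt (by simp)
  have h4 : Function.Injective (mfderiv (𝓡 n) (𝓡 n) e.symm x) := by
    have h5 : (e ∘ e.symm) =ᶠ[𝓝 x] id := by
      filter_upwards [e.open_target.mem_nhds hx] with y hy using e.right_inv hy
    have h6 := mfderiv_comp x h3 h1
    rw [h5.mfderiv_eq, mfderiv_id] at h6
    refine Function.LeftInverse.injective (g := mfderiv (𝓡 n) (𝓡 n) e (e.symm x)) fun v => ?_
    exact (congrArg (fun L : Eucl n →L[ℝ] Eucl n => L v) h6).symm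
  rw [← mfderiv_eq_fderiv, mfderiv_comp x h2 h1]
  exact (h.injective_mfderiv _).comp h4

end Charts

end FlatNormal

theorem corollary19 (n m : ℕ) :
    -- the direct statement
    (∀ (U V : Set (FlatNormal.Eucl n)) (φ : Fin m → FlatNormal.Eucl n → ℝ)
      (Ω : FlatNormal.Eucl n → Matrix (Fin m) (Fin m) ℝ),
      FlatNormal.IsRibaucourData U V φ Ω →
        (∀ x ∈ V, (FlatNormal.matW φ Ω x).transpose * FlatNormal.matW φ Ω x = 1) ∧
        ∀ j : Fin m, FlatNormal.IsSphericalImmersionWithFlatNormalBundleOn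
          (FlatNormal.colW φ Ω j) (FlatNormal.regularSet V φ Ω j)) ∧
    -- the converse: locally, up to a rigid motion of the sphere and in suitable coordinates
    (∀ (M : Type*) [TopologicalSpace M] [ChartedSpace (FlatNormal.Eucl n) M]
      [IsManifold (𝓡 n) ∞ M] (f : M → FlatNormal.Amb n m),
      FlatNormal.IsSphericalImmersionWithFlatNormalBundle n f →
        ∀ (p : M) (j : Fin m),
          ∃ (U V : Set (FlatNormal.Eucl n)) (φ : Fin m → FlatNormal.Eucl n → ℝ)
            (Ω : FlatNormal.Eucl n → Matrix (Fin m) (Fin m) ℝ),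
            FlatNormal.IsRibaucourData U V φ Ω ∧
            ∃ T : FlatNormal.Amb n m ≃ₗᵢ[ℝ] FlatNormal.Amb n m,
            ∃ e ∈ IsManifold.maximalAtlas (𝓡 n) ∞ M,
              p ∈ e.source ∧ e.target = V ∧
              ∀ x ∈ V, T (f (e.symm x)) = FlatNormal.colW φ Ω j x) := by
  refine ⟨fun U V φ Ω h => ⟨fun x hx => h.transpose_matW_mul_matW hx, fun j =>
    h.isSphericalImmersionWithFlatNormalBundleOn_colW j⟩, ?_⟩
  intro M _ _ _ f hf p j
  have he := IsManifold.chart_mem_maximalAtlas (I := 𝓡 n) (n := ∞) p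
  set e := chartAt (FlatNormal.Eucl n) p
  have hg := hf.comp_symm he
  have hx₀ : e p ∈ e.target := e.map_source (mem_chart_source _ p)
  obtain ⟨X, r, hr, hrR, hXj, hX, hon, hd⟩ := hg.exists_frame hx₀ (κ := Fin m) (by simp) j
  obtain ⟨V, φ, Ω, T, ψ, hdata, hψ₀, hψR, hψ, hψs, hψt, hcol⟩ :=
    FlatNormal.exists_isRibaucourData_of_frame Metric.isOpen_ball hX hon hd
      (Metric.mem_ball_self hr) j (by rw [hXj]; exact hg.injective_fderiv _ hx₀)
  refine ⟨V, V, φ, Ω, hdata, T, e.trans ψ, FlatNormal.trans_mem_maximalAtlas he hψ hψs, ?_, ?_, ?_⟩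
  · rw [OpenPartialHomeomorph.trans_source]
    exact ⟨mem_chart_source _ p, hψ₀⟩
  · rw [OpenPartialHomeomorph.trans_target, hψt, Set.inter_eq_left]
    intro y hy
    exact hrR (hψR (ψ.map_target (hψt ▸ hy)))
  · intro x hx
    rw [← hcol x hx, hXj]
    rfl
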